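/- **Setting.** A game graph $G=((S,E),(S_1,S_2))$ is a finite directed graph with $m=|E|$ edges in which every state $s$ has a non-empty set $E(s)$ of successors, with a partition $S=S_1\cup S_2$ into player-1 and player-2 states; $B\subseteq S$ is a set of Büchi states and $C=S\setminus B$. For $V,U\subseteq S$, $\mathit{Attr}_\ell(U,G\upharpoonright V)$ is the least set $R\subseteq V$ that contains $U\cap V$, every $s\in V\cap S_\ell$ with $E(s)\cap R\ne\emptyset$ and every $s\in V\setminus S_\ell$ with $E(s)\cap V\subseteq R$. Both algorithms start with $S^0=S$ and in iteration $i$, with $G_i=G\upharpoonright S^i$, compute a set $\mathit{Tr}_i\subseteq S^i$ (the trap), $W_{i+1}=\mathit{Attr}_2(\mathit{Tr}_i,G_i)$ and $S^{i+1}=S^i\setminus W_{i+1}$; they stop at the end of the first iteration with $W_{i+1}=\emptyset$. * Classical algorithm: $\mathit{Tr}_i=S^i\setminus R_i$ with $R_i=\mathit{Attr}_1(B\cap S^i,G_i)$. * Alternative algorithm: with $C^i=C\cap S^i$, let $C_1^i=\{s\in S_1\cap C^i: E(s)\cap S^i\subseteq C^i\}$, $C_2^i=\{s\in S_2\cap C^i: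 E(s)\cap C^i\neq\emptyset\}$, $X_i=\mathit{Attr}_2(C_1^i\cup C_2^i,G_i)$, $Z_i=X_i\cap C^i$, $D_i=\{s\in S_1\cap Z_i: E(s)\cap (S^i\setminus Z_i)\ne\emptyset\}\cup\{s\in S_2\cap Z_i: E(s)\cap S^i\subseteq S^i\setminus Z_i\}\cup(X_i\setminus Z_i)$, $L_i=\mathit{Attr}_1(D_i,G_i\upharpoonright X_i)$, and $\mathit{Tr}_i=Z_i\setminus L_i$. **Implementation and cost.** The input is given by adjacency lists (successors and predecessors, in any order). Every attractor is computed by a backward search with a stack over the incoming edges of the states found, with counters for the opponent's states; removed states are deleted from the lists with all their incident edges, and out-degrees are maintained. In the classical algorithm $\mathit{Tr}_i$ is found by scanning the list of $S^i$. In the alternative algorithm $D_i$ is found by scanning the outgoing edges of $Z_i$, and $C_1^i\cup C_2^i$ is initialized once and then maintained during the deletions, using for each state a counter of its edges into $B$. A *step* is a bounded number of elementary random-access operations; inspecting an edge takes a step. A run consists of the phases: initialization and, in each iteration, (a) computation of $\mathit{Tr}_i$ (in the alternative algorithm from the set $C_1^i\cup C_2^i$), (b) computation of $W_{i+1}$,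 (c) deletion of $W_{i+1}$ with the update of counters and lists. Let $\mathsf{T}_1(G,B)$, $\mathsf{T}_2(G,B)$ be the total numbers of steps of the classical and the alternative algorithm. Let the running time in edge units, $\mathsf{RT}_1(G,B)$ and $\mathsf{RT}_2(G,B)$, be the sum over all phases of the number of edges on which the phase works (the constant amount of work that a phase does on an edge counts as one unit). **Theorem (Running time of the alternative algorithm).** There is an absolute constant $c$ such that for all game graphs $G$, all adjacency lists of $G$ and all $B\subseteq S$, the two implementations compute in every iteration exactly the sets of the respective algorithm and stop when that algorithm stops, and: 1. $\mathsf{RT}_2(G,B)\le \mathsf{RT}_1(G,B)+c\,m$. 2. $\mathsf{RT}_j(G,B)\le \mathsf{T}_j(G,B)\le c\,(\mathsf{RT}_j(G,B)+1)$ for $j=1,2$, i.e. $\mathsf{RT}_j$ is the number of elementary steps up to a constant factor; and $\mathsf{T}_2(G,B)\le c\,(\mathsf{T}_1(G,B)+m)$. 3. In the alternative algorithm, initialization and all phases (c), including all the work for initializing and maintaining the sets $C_1^i$ and $C_2^i$, take at most $c\,m$ steps in total. Both algorithms make the same number of iterations, and in each iteration $i$ the number of edges on which phase (a) works in the alternative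 algorithm is at most that number for the classical algorithm plus $c\,t_i$, where $t_i$ is the number of trap edges, the edges of $G_i$ that enter the trap $\mathit{Tr}_i$ of the alternative algorithm. Since these edges are removed in iteration $i$, $\sum_i t_i\le m$. -/

import Mathlib

/-! ### Game graphs and the two iterative algorithms on the level of sets -/

/-- A turn-based game graph on the states `S`: the edges, the player-1 states `S₁` (all other
states belong to player 2), and every state has a successor. -/
structure GameGraph (S : Type*) where
  E : Finset (S × S)
  S₁ : Finset S
  total : ∀ s, ∃ t, (s, t) ∈ E

namespace GameGraph

variable {S : Type*}

/-- The inductive attractor in `G ↾ V`: the least set that contains `U ∩ V`, every state of `own`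
with a successor in the set, and every other state all of whose successors in `V` are in it. -/
inductive Attr (G : GameGraph S) (V own U : Set S) : S → Prop
  | base {s : S} : s ∈ V → s ∈ U → Attr G V own U s
  | own {s t : S} : s ∈ V → s ∈ own → (s, t) ∈ G.E → Attr G V own U t → Attr G V own U s
  | opp {s : S} : s ∈ V → s ∉ own → (∀ t ∈ V, (s, t) ∈ G.E → Attr G V own U t) →
      Attr G V own U s

/-- `Attr₁(U, G ↾ V)`. -/
def attr₁ (G : GameGraph S) (V U : Set S) : Set S := {s | G.Attr V (G.S₁ : Set S) U s}

/-- `Attr₂(U, G ↾ V)`. -/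
def attr₂ (G : GameGraph S) (V U : Set S) : Set S := {s | G.Attr V (G.S₁ : Set S)ᶜ U s}

/-- `R` of the classical algorithm on the state set `V`. -/
def reachSet (G : GameGraph S) (B : Finset S) (V : Set S) : Set S := G.attr₁ V (B ∩ V)

/-- `Tr` of the classical algorithm on the state set `V`. -/
def classicalTrap (G : GameGraph S) (B : Finset S) (V : Set S) : Set S := V \ G.reachSet B V

/-- Player-1 states outside `B` all of whose successors are outside `B`. -/
def C₁ (G : GameGraph S) (B : Finset S) (V : Set S) : Set S :=
  {s | s ∈ V ∧ s ∉ B ∧ s ∈ G.S₁ ∧ ∀ t ∈ V, (s, t) ∈ G.E → t ∉ B}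

/-- Player-2 states outside `B` with a successor outside `B`. -/
def C₂ (G : GameGraph S) (B : Finset S) (V : Set S) : Set S :=
  {s | s ∈ V ∧ s ∉ B ∧ s ∉ G.S₁ ∧ ∃ t ∈ V, (s, t) ∈ G.E ∧ t ∉ B}

def X (G : GameGraph S) (B : Finset S) (V : Set S) : Set S :=
  G.attr₂ V (G.C₁ B V ∪ G.C₂ B V)

def Z (G : GameGraph S) (B : Finset S) (V : Set S) : Set S := G.X B V ∩ (V \ B)

def D (G : GameGraph S) (B : Finset S) (V : Set S) : Set S :=
  {s | s ∈ G.S₁ ∧ s ∈ G.Z B V ∧ ∃ t ∈ V, (s, t) ∈ G.E ∧ t ∉ G.Z B V} ∪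
  {s | s ∉ G.S₁ ∧ s ∈ G.Z B V ∧ ∀ t ∈ V, (s, t) ∈ G.E → t ∉ G.Z B V} ∪
  (G.X B V \ G.Z B V)

def L (G : GameGraph S) (B : Finset S) (V : Set S) : Set S := G.attr₁ (G.X B V) (G.D B V)

/-- `Tr` of the alternative algorithm on the state set `V`. -/
def altTrap (G : GameGraph S) (B : Finset S) (V : Set S) : Set S := G.Z B V \ G.L B V

/-- The state sets `S⁰ = S`, `Sⁱ⁺¹ = Sⁱ \ Attr₂(Trᵢ, G ↾ Sⁱ)`, for a given choice of traps. -/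
def stateSeq (G : GameGraph S) (trap : Set S → Set S) : ℕ → Set S
  | 0 => Set.univ
  | i + 1 => G.stateSeq trap i \ G.attr₂ (G.stateSeq trap i) (trap (G.stateSeq trap i))

/-- Adjacency-list input: an enumeration of the states, and for each state the list of its
successors and the list of its predecessors, in any order. -/
structure AdjList (G : GameGraph S) where
  states : List S
  succ : S → List S
  pred : S → List S
  nodup_states : states.Nodup
  mem_states : ∀ s, s ∈ states
  nodup_succ : ∀ s, (succ s).Nodup
  mem_succ : ∀ s t, t ∈ succ s ↔ (s, t) ∈ G.E
  nodup_pred : ∀ t, (pred t).Nodup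
  mem_pred : ∀ s t, s ∈ pred t ↔ (s, t) ∈ G.E

end GameGraph

/-! ### Step-counted computations

A function on the states is a random-access array (one lookup or update is an elementary
operation, and so is the allocation of a zeroed array), a list is a doubly linked list with
pointers to its nodes (pushing, popping and deleting an element are elementary operations).
Programs pay one step for a bounded number of elementary operations, and record each
edge that they inspect. -/

/-- A value, the number of steps spent on it, and the set of edges inspected. -/
structure Timed (S : Type*) (α : Type*) where
  val : α
  steps : ℕ
  edges : Finset (S × S)

/-- Two meters of a completed phase of a computation: the number of steps, and the number of edges
on which the phase has worked (an edge is counted once, however often the phase returns to it). -/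
structure Cost where
  steps : ℕ
  work : ℕ

namespace Timed

universe u
variable {S : Type u}

instance [DecidableEq S] : Monad (Timed S) where
  pure a := ⟨a, 0, ∅⟩
  bind m f := ⟨(f m.val).val, m.steps + (f m.val).steps, m.edges ∪ (f m.val).edges⟩

/-- Spend one step. -/
def tick : Timed S PUnit := ⟨PUnit.unit, 1, ∅⟩

/-- Spend one step to inspect the edge `e`. -/
def visit (e : S × S) : Timed S PUnit := ⟨PUnit.unit, 1, {e}⟩

def cost {α : Type*} (m : Timed S α) : Cost := ⟨m.steps, m.edges.card⟩

/-- Scan a list and collect the elements that satisfy `p`. -/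
def select [DecidableEq S] (p : S → Bool) (l : List S) : Timed S (List S) :=
  l.foldlM (fun acc s => do
    tick
    return if p s then s :: acc else acc) []

end Timed

/-! ### Backward search for attractors -/

/-- State of a backward search: the states found so far (as an array of marks and as a list), for
each state the number of its edges already found to lead to marked states, and the stack of
found states whose incoming edges have not been inspected yet. -/
structure Search (S : Type*) where
  mark : S → Bool
  hits : S → ℕ
  found : List S
  stack : List S

namespace Search

universe u
variable {S : Type u} [DecidableEq S]

def empty : Search S := ⟨fun _ => false, fun _ => 0, [], []⟩

def add (σ : Search S) (v : S) : Search S :=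
  { σ with mark := Function.update σ.mark v true, found := v :: σ.found, stack := v :: σ.stack }

/-- Inspect the edge from `u` to the found state `v`. A state of the searching player is added at
once; another state is added when all its `deg u` edges have been inspected. -/
def inspect (deg : S → ℕ) (own within : S → Bool) (v : S) (σ : Search S) (u : S) :
    Timed S (Search S) := do
  Timed.visit (u, v)
  if within u && !σ.mark u then
    if own u then
      return σ.add u
    else
      let k := σ.hits u + 1
      let σ' : Search S := { σ with hits := Function.update σ.hits u k }
      if k = deg u then return σ'.add u else return σ'
  else
    return σ

/-- Process the stack until it is empty. Every round pops one state, and no state is pushed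
twice, so the bound on the number of rounds is not reached before that when it is at
least the number of states. -/
def loop (pred : S → List S) (deg : S → ℕ) (own within : S → Bool) :
    ℕ → Search S → Timed S (Search S)
  | 0, σ => return σ
  | k + 1, σ =>
    match σ.stack with
    | [] => return σ
    | v :: rest => do
      Timed.tick
      let σ' ← (pred v).foldlM (inspect deg own within v) { σ with stack := rest }
      loop pred deg own within k σ'

/-- The attractor to `target` of the player who owns the states `own`, in the graph given by the
lists `pred`, restricted to `within`; `deg` is the out-degree in the restricted graph. -/
def run (n : ℕ) (pred : S → List S) (deg : S → ℕ) (own within : S → Bool) (target : List S) :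
    Timed S (Search S) := do
  Timed.tick
  let σ ← target.foldlM (fun σ v => do
    Timed.tick
    return σ.add v) empty
  loop pred deg own within n σ

end Search

namespace GameGraph

universe u
variable {S : Type u} [DecidableEq S]

/-! ### The classical algorithm -/

/-- Memory of the classical algorithm: the adjacency lists and the out-degrees of the current
game graph, its states and its Büchi states. -/
structure CMem (S : Type*) where
  succ : S → List S
  pred : S → List S
  deg : S → ℕ
  states : List S
  buchi : List S

/-- Record of one iteration of the classical algorithm: the computed sets, and the costs of
computing the trap, of computing the set to be removed, and of removing it. -/
structure CIter (S : Type*) where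
  reach : List S
  trap : List S
  removed : List S
  trapCost : Cost
  attrCost : Cost
  removeCost : Cost

def AdjList.cInit {G : GameGraph S} (A : G.AdjList) (B : Finset S) : Timed S (CMem S) :=
  A.states.foldlM (fun c s => do
    Timed.tick
    let k ← (A.succ s).foldlM (fun k t => do
      Timed.visit (s, t)
      return ULift.up (k.down + 1)) (ULift.up 0)
    return { c with
      deg := Function.update c.deg s k.down
      buchi := if s ∈ B then s :: c.buchi else c.buchi })
    ⟨A.succ, A.pred, fun _ => 0, A.states, []⟩

/-- `R := Attr₁(B, G)` and `Tr := S \ R` on the current graph. -/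
def cTrap (G : GameGraph S) (n : ℕ) (c : CMem S) : Timed S (List S × List S) := do
  let σ ← Search.run n c.pred c.deg (fun s => s ∈ G.S₁) (fun _ => true) c.buchi
  let tr ← Timed.select (fun s => !σ.mark s) c.states
  return (σ.found, tr)

/-- `Attr₂(Tr, G)` on the current graph (used by both algorithms). -/
def removable (G : GameGraph S) (n : ℕ) (pred : S → List S) (deg : S → ℕ) (tr : List S) :
    Timed S (List S) := do
  let σ ← Search.run n pred deg (fun s => s ∉ G.S₁) (fun _ => true) tr
  return σ.found

/-- Remove the states `w` with all incident edges from the current graph. -/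
def cRemove (w : List S) (c : CMem S) : Timed S (CMem S) :=
  w.foldlM (fun c v => do
    Timed.tick
    let c₁ : CMem S := { c with states := c.states.erase v, buchi := c.buchi.erase v }
    let c₂ ← (c₁.succ v).foldlM (fun c t => do
      Timed.visit (v, t)
      return { c with pred := Function.update c.pred t ((c.pred t).erase v) }) c₁
    (c₂.pred v).foldlM (fun c u => do
      Timed.visit (u, v)
      return { c with
        succ := Function.update c.succ u ((c.succ u).erase v)
        deg := Function.update c.deg u (c.deg u - 1) }) c₂) c

/-- Iterate until the removed set is empty. Every other iteration removes a state, so the bound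
on the number of iterations is not reached before that when it exceeds the number of
states. -/
def cLoop (G : GameGraph S) (n : ℕ) : ℕ → CMem S → List (CIter S)
  | 0, _ => []
  | k + 1, c =>
    let p := G.cTrap n c
    let w := G.removable n c.pred c.deg p.val.2
    let r := cRemove w.val c
    ⟨p.val.1, p.val.2, w.val, p.cost, w.cost, r.cost⟩ ::
      (if w.val.isEmpty then [] else cLoop G n k r.val)

/-- A complete run of the classical algorithm. -/
structure CRun (S : Type*) where
  initCost : Cost
  iters : List (CIter S)

def AdjList.classical {G : GameGraph S} (A : G.AdjList) (B : Finset S) : CRun S :=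
  ⟨(A.cInit B).cost, G.cLoop A.states.length (A.states.length + 1) (A.cInit B).val⟩

/-- Number of steps of the whole run. -/
def CRun.steps {S : Type*} (r : CRun S) : ℕ :=
  r.initCost.steps +
    (r.iters.map fun a => a.trapCost.steps + a.attrCost.steps + a.removeCost.steps).sum

/-- Work of the whole run: the number of edges worked on, added up over all phases. -/
def CRun.work {S : Type*} (r : CRun S) : ℕ :=
  r.initCost.work +
    (r.iters.map fun a => a.trapCost.work + a.attrCost.work + a.removeCost.work).sum

/-- The run computes the sets prescribed by the classical algorithm, and stops at the end of the
first iteration whose removed set is empty. -/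
def CRun.Computes (G : GameGraph S) (B : Finset S) (r : CRun S) : Prop :=
  r.iters ≠ [] ∧ ∀ (i : ℕ) (h : i < r.iters.length),
    let V := G.stateSeq (G.classicalTrap B) i
    {s | s ∈ r.iters[i].reach} = G.reachSet B V ∧
    {s | s ∈ r.iters[i].trap} = G.classicalTrap B V ∧
    {s | s ∈ r.iters[i].removed} = G.attr₂ V (G.classicalTrap B V) ∧
    (r.iters[i].removed = [] ↔ i + 1 = r.iters.length)

/-! ### The alternative algorithm -/

/-- Memory of the alternative algorithm: the adjacency lists and the out-degrees of the current
game graph, for each state the number of its edges into Büchi states, and the current set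
`C₁ ∪ C₂`. -/
structure AMem (S : Type*) where
  succ : S → List S
  pred : S → List S
  deg : S → ℕ
  toB : S → ℕ
  cand : List S

/-- The sets computed on the way to the trap of the alternative algorithm, and the trap. -/
structure ASets (S : Type*) where
  X : List S
  Z : List S
  D : List S
  L : List S
  trap : List S

/-- Record of one iteration of the alternative algorithm: the computed sets (`cand` is the set
`C₁ ∪ C₂`), and the costs of computing the trap from `cand`, of computing the set to be
removed, and of removing it together with the update of the counters and of `cand`. -/
structure AIter (S : Type*) where
  cand : List S
  sets : ASets S
  removed : List S
  trapCost : Cost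
  attrCost : Cost
  removeCost : Cost

def AdjList.aInit {G : GameGraph S} (A : G.AdjList) (B : Finset S) : Timed S (AMem S) :=
  A.states.foldlM (fun c s => do
    Timed.tick
    let q ← (A.succ s).foldlM (fun q t => do
      Timed.visit (s, t)
      return ULift.up (q.down.1 + 1, if t ∈ B then q.down.2 + 1 else q.down.2))
      (ULift.up ((0, 0) : ℕ × ℕ))
    let isCand : Prop := s ∉ B ∧ if s ∈ G.S₁ then q.down.2 = 0 else q.down.2 < q.down.1
    return { c with
      deg := Function.update c.deg s q.down.1
      toB := Function.update c.toB s q.down.2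
      cand := if isCand then s :: c.cand else c.cand })
    ⟨A.succ, A.pred, fun _ => 0, fun _ => 0, []⟩

/-- Steps from `X := Attr₂(C₁ ∪ C₂, G)` to `Tr := Z \ L`. The scan that computes `D` also counts,
for each state of `Z`, the successors in `X`, as needed for the search in `G ↾ X`. -/
def aTrap (G : GameGraph S) (B : Finset S) (n : ℕ) (c : AMem S) : Timed S (ASets S) := do
  let σX ← Search.run n c.pred c.deg (fun s => s ∉ G.S₁) (fun _ => true) c.cand
  let Z ← Timed.select (fun s => s ∉ B) σX.found
  let p ← σX.found.foldlM (fun p s => do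
    Timed.tick
    if s ∈ B then
      return (p.1, s :: p.2)
    else
      let q ← (c.succ s).foldlM (fun q t => do
        Timed.visit (s, t)
        return ULift.up
          (if σX.mark t then q.down.1 + 1 else q.down.1,
            if σX.mark t && t ∉ B then q.down.2 + 1 else q.down.2))
        (ULift.up ((0, 0) : ℕ × ℕ))
      let escapes : Prop := if s ∈ G.S₁ then q.down.2 < c.deg s else q.down.2 = 0
      return (Function.update p.1 s q.down.1, if escapes then s :: p.2 else p.2))
    (((fun _ => 0), []) : (S → ℕ) × List S)
  let σL ← Search.run n c.pred p.1 (fun s => s ∈ G.S₁) σX.mark p.2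
  let tr ← Timed.select (fun s => !σL.mark s) Z
  return ⟨σX.found, Z, p.2, σL.found, tr⟩

/-- Remove the states `w` with all incident edges from the current graph, and update the counters
and the set `C₁ ∪ C₂`: when the last edge of a player-1 state outside `B` into `B` is removed,
this state joins the set. -/
def aRemove (G : GameGraph S) (B : Finset S) (w : List S) (c : AMem S) : Timed S (AMem S) :=
  w.foldlM (fun c v => do
    Timed.tick
    let c₁ : AMem S := { c with cand := c.cand.erase v }
    let c₂ ← (c₁.succ v).foldlM (fun c t => do
      Timed.visit (v, t)
      return { c with pred := Function.update c.pred t ((c.pred t).erase v) }) c₁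
    (c₂.pred v).foldlM (fun c u => do
      Timed.visit (u, v)
      let c' : AMem S := { c with
        succ := Function.update c.succ u ((c.succ u).erase v)
        deg := Function.update c.deg u (c.deg u - 1) }
      if v ∈ B then
        return { c' with
          toB := Function.update c.toB u (c.toB u - 1)
          cand := if c.toB u = 1 ∧ u ∈ G.S₁ ∧ u ∉ B then u :: c.cand else c.cand }
      else
        return c') c₂) c

def aLoop (G : GameGraph S) (B : Finset S) (n : ℕ) : ℕ → AMem S → List (AIter S)
  | 0, _ => []
  | k + 1, c =>
    let p := G.aTrap B n c
    let w := G.removable n c.pred c.deg p.val.trap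
    let r := G.aRemove B w.val c
    ⟨c.cand, p.val, w.val, p.cost, w.cost, r.cost⟩ ::
      (if w.val.isEmpty then [] else aLoop G B n k r.val)

/-- A complete run of the alternative algorithm. -/
structure ARun (S : Type*) where
  initCost : Cost
  iters : List (AIter S)

def AdjList.alternative {G : GameGraph S} (A : G.AdjList) (B : Finset S) : ARun S :=
  ⟨(A.aInit B).cost, G.aLoop B A.states.length (A.states.length + 1) (A.aInit B).val⟩

/-- Number of steps of the whole run. -/
def ARun.steps {S : Type*} (r : ARun S) : ℕ :=
  r.initCost.steps +
    (r.iters.map fun a => a.trapCost.steps + a.attrCost.steps + a.removeCost.steps).sum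

/-- Work of the whole run: the number of edges worked on, added up over all phases. -/
def ARun.work {S : Type*} (r : ARun S) : ℕ :=
  r.initCost.work +
    (r.iters.map fun a => a.trapCost.work + a.attrCost.work + a.removeCost.work).sum

/-- Number of steps spent on the first computation of the graph data and of `C₁ ∪ C₂`, and on
their maintenance over all iterations. -/
def ARun.maintenanceSteps {S : Type*} (r : ARun S) : ℕ :=
  r.initCost.steps + (r.iters.map fun a => a.removeCost.steps).sum

/-- The run computes the sets prescribed by the alternative algorithm, and stops at the end of
the first iteration whose removed set is empty. -/
def ARun.Computes (G : GameGraph S) (B : Finset S) (r : ARun S) : Prop :=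
  r.iters ≠ [] ∧ ∀ (i : ℕ) (h : i < r.iters.length),
    let V := G.stateSeq (G.altTrap B) i
    {s | s ∈ r.iters[i].cand} = G.C₁ B V ∪ G.C₂ B V ∧
    {s | s ∈ r.iters[i].sets.X} = G.X B V ∧
    {s | s ∈ r.iters[i].sets.Z} = G.Z B V ∧
    {s | s ∈ r.iters[i].sets.D} = G.D B V ∧
    {s | s ∈ r.iters[i].sets.L} = G.L B V ∧
    {s | s ∈ r.iters[i].sets.trap} = G.altTrap B V ∧
    {s | s ∈ r.iters[i].removed} = G.attr₂ V (G.altTrap B V) ∧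
    (r.iters[i].removed = [] ↔ i + 1 = r.iters.length)

/-- The trap edges of iteration `i`: the edges of the current graph that enter its trap. -/
def trapEdges (G : GameGraph S) (B : Finset S) (i : ℕ) : Set (S × S) :=
  {e | e ∈ G.E ∧ e.1 ∈ G.stateSeq (G.altTrap B) i ∧
    e.2 ∈ G.altTrap B (G.stateSeq (G.altTrap B) i)}

end GameGraph

-- The two algorithms compute the same trap on every state set `V`. Let `R` be the player-1
-- attractor of the Büchi states and `T = V \ R`. A player-1 state of `T` has all its successors in
-- `T`, a player-2 state has one there, and `T` avoids `B`; hence `T` lies in `C₁ ∪ C₂` and so in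
-- `Z`. No state of `T` is in `D`, and the attractor `L` cannot enter a set with these closure
-- properties, so `T ⊆ Z \ L`. Conversely, an induction along `R` shows `R ∩ Z ⊆ L`: a step of the
-- attractor that leaves `Z` passes through `D`. This is `altTrap_eq_classicalTrap`; it makes the
-- removed sets, the iterations and the work of phases (b) and (c) coincide, so only initialization
-- and phase (a) remain to be compared.
--
-- In phase (a) the classical search works on exactly the edges into `R`. The alternative one works
-- on some edges of `G ↾ V`, and each of these ends either in `R` or in the trap
-- (`ncard_scanned_le`). The surplus is therefore at most the number of trap edges; these disappear
-- with the removed set, so they sum to at most `m` (`sum_trapEdges_le`). Both initializations work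
-- on all `m` edges.
--
-- Steps and work differ by the handling of states, which is charged to edges: every state of the
-- current graph has a successor there, since removing a player-2 attractor preserves this
-- (`TotalOn.diff_attr₂`). The leftover constant per iteration is absorbed by an edge whenever
-- something is removed, and only the last iteration removes nothing.
--
-- For the candidates, `C₂` does not change on surviving states, because a surviving player-2 state
-- has no edge into the removed attractor (`mem_C₂_diff_attr₂`); `C₁` grows exactly when a counter
-- of edges into `B` falls to zero. The programs are tied to the sets by an invariant of backward
-- search (`Search.Inv`) and by representation predicates for the memories.

universe u v

/-! ### Values, steps and edges of step-counted folds. -/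

namespace Timed

section
variable {S : Type u} [DecidableEq S] {α β : Type v}

@[simp] theorem val_pure (a : α) : (pure a : Timed S α).val = a := rfl
@[simp] theorem steps_pure (a : α) : (pure a : Timed S α).steps = 0 := rfl
@[simp] theorem edges_pure (a : α) : (pure a : Timed S α).edges = ∅ := rfl
@[simp] theorem val_bind (m : Timed S α) (f : α → Timed S β) :
    (m >>= f).val = (f m.val).val := rfl
@[simp] theorem steps_bind (m : Timed S α) (f : α → Timed S β) :
    (m >>= f).steps = m.steps + (f m.val).steps := rfl
@[simp] theorem edges_bind (m : Timed S α) (f : α → Timed S β) :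
    (m >>= f).edges = m.edges ∪ (f m.val).edges := rfl

end

section
variable {S : Type u}

@[simp] theorem steps_tick : (tick : Timed S PUnit.{v + 1}).steps = 1 := rfl
@[simp] theorem edges_tick : (tick : Timed S PUnit.{v + 1}).edges = ∅ := rfl
@[simp] theorem steps_visit (e : S × S) : (visit e : Timed S PUnit.{v + 1}).steps = 1 := rfl
@[simp] theorem edges_visit (e : S × S) : (visit e : Timed S PUnit.{v + 1}).edges = {e} := rfl
end

section
variable {S : Type u} [DecidableEq S] {α : Type v} {γ : Type*}

theorem val_foldlM (f : α → γ → Timed S α) (l : List γ) (a : α) :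
    (l.foldlM f a).val = l.foldl (fun a x => (f a x).val) a := by
  induction l generalizing a with
  | nil => rfl
  | cons x l ih => simp [List.foldlM_cons, ih]

theorem steps_foldlM {f : α → γ → Timed S α} (hf : ∀ a x, (f a x).steps = 1) (l : List γ) (a : α) :
    (l.foldlM f a).steps = l.length := by
  induction l generalizing a with
  | nil => rfl
  | cons x l ih => simp [List.foldlM_cons, ih, hf, add_comm]

theorem edges_foldlM {f : α → γ → Timed S α} {h : γ → S × S} (hf : ∀ a x, (f a x).edges = {h x})
    (l : List γ) (a : α) : (l.foldlM f a).edges = (l.map h).toFinset := by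
  induction l generalizing a with
  | nil => rfl
  | cons x l ih =>
    simp only [List.foldlM_cons, edges_bind, ih, hf, List.map_cons, List.toFinset_cons]
    rfl

theorem edges_foldlM_empty {f : α → γ → Timed S α} (hf : ∀ a x, (f a x).edges = ∅)
    (l : List γ) (a : α) : (l.foldlM f a).edges = ∅ := by
  induction l generalizing a with
  | nil => rfl
  | cons x l ih => simp [List.foldlM_cons, ih, hf]

@[simp] theorem steps_select (p : S → Bool) (l : List S) : (select p l).steps = l.length :=
  steps_foldlM (by simp) _ _

@[simp] theorem edges_select (p : S → Bool) (l : List S) : (select p l).edges = ∅ :=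
  edges_foldlM_empty (by simp) _ _

theorem val_select (p : S → Bool) (l : List S) : (select p l).val = (l.filter p).reverse := by
  have key : ∀ acc : List S, l.foldl (fun acc s => if p s then s :: acc else acc) acc =
      (l.filter p).reverse ++ acc := by
    induction l with
    | nil => simp
    | cons x l ih =>
      intro acc
      by_cases h : p x <;> simp [h, ih]
  rw [select, val_foldlM]
  simpa using key []

end

end Timed

/-! ### Correctness and exact cost of the backward search. -/

namespace Search

variable {S : Type u} [DecidableEq S]

/-- The state `u` is found by the inspection of one of its edges to a found state. -/
def IsNew (deg : S → ℕ) (own within : S → Bool) (σ : Search S) (u : S) : Prop :=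
  within u = true ∧ σ.mark u = false ∧ (own u = true ∨ σ.hits u + 1 = deg u)

instance (deg : S → ℕ) (own within : S → Bool) (σ : Search S) :
    DecidablePred (IsNew deg own within σ) := fun _ => inferInstanceAs (Decidable (_ ∧ _))

variable (deg : S → ℕ) (own within : S → Bool) (v : S)

theorem steps_inspect (σ : Search S) (u : S) : (inspect deg own within v σ u).steps = 1 := by
  unfold inspect
  simp only [Timed.steps_bind, Timed.steps_visit]
  split_ifs <;> rfl

theorem edges_inspect (σ : Search S) (u : S) :
    (inspect deg own within v σ u).edges = {(u, v)} := by
  unfold inspect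
  simp only [Timed.edges_bind, Timed.edges_visit]
  split_ifs <;> simp

/-- All branches of the program are merged into one record whose arrays are updated at `u`
unconditionally, so that a whole fold can be described pointwise. -/
theorem val_inspect (σ : Search S) (u : S) :
    (inspect deg own within v σ u).val =
      { mark := Function.update σ.mark u (σ.mark u || decide (IsNew deg own within σ u))
        hits := Function.update σ.hits u
          (if within u && !σ.mark u && !own u then σ.hits u + 1 else σ.hits u)
        found := if IsNew deg own within σ u then u :: σ.found else σ.found
        stack := if IsNew deg own within σ u then u :: σ.stack else σ.stack } := by
  unfold inspect IsNew
  simp only [Timed.val_bind]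
  rcases Bool.eq_false_or_eq_true (within u) with hw | hw <;>
    rcases Bool.eq_false_or_eq_true (σ.mark u) with hm | hm <;>
    rcases Bool.eq_false_or_eq_true (own u) with ho | ho <;>
    by_cases hd : σ.hits u + 1 = deg u <;>
    simp [hw, hm, ho, hd, add] <;> simp [← hm]

/-- Without repetitions in `l`, inspecting one state changes neither the mark nor the counter of a
later one, so every decision can be read off from the initial `σ`. -/
theorem val_foldlM_inspect (l : List S) (hl : l.Nodup) (σ : Search S) :
    (l.foldlM (inspect deg own within v) σ).val =
      { mark := fun u => σ.mark u || decide (u ∈ l ∧ IsNew deg own within σ u)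
        hits := fun u => if u ∈ l ∧ within u && !σ.mark u && !own u then σ.hits u + 1 else σ.hits u
        found := (l.filter (fun u => IsNew deg own within σ u)).reverse ++ σ.found
        stack := (l.filter (fun u => IsNew deg own within σ u)).reverse ++ σ.stack } := by
  induction l generalizing σ with
  | nil => simp
  | cons x l ih =>
    obtain ⟨hx, hl⟩ := List.nodup_cons.1 hl
    rw [List.foldlM_cons, Timed.val_bind, ih hl, val_inspect]
    have hn : ∀ u, u ≠ x → ∀ a b f g, (IsNew deg own within
        ⟨Function.update σ.mark x a, Function.update σ.hits x b, f, g⟩ u ↔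
        IsNew deg own within σ u) := by
      intro u hu a b f g
      simp [IsNew, hu]
    have hfil : ∀ a b f g, l.filter (fun u => IsNew deg own within
        ⟨Function.update σ.mark x a, Function.update σ.hits x b, f, g⟩ u) =
        l.filter (fun u => IsNew deg own within σ u) := by
      intro a b f g
      refine List.filter_congr fun u hu => ?_
      rw [decide_eq_decide]
      exact hn u (fun h => hx (h ▸ hu)) _ _ _ _
    rw [hfil]
    congr 1
    · funext u
      by_cases hu : u = x
      · subst hu; simp [hx]
      · simp [hu, hn u hu]
    · funext u
      by_cases hu : u = x
      · subst hu; simp [hx]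
      · simp [hu]
    · by_cases h : IsNew deg own within σ x <;> simp [h]
    · by_cases h : IsNew deg own within σ x <;> simp [h]

end Search

theorem GameGraph.Attr.mem {S : Type u} {G : GameGraph S} {V O T : Set S} {s : S}
    (h : G.Attr V O T s) : s ∈ V := by
  cases h <;> assumption

namespace Search

variable {S : Type u} [DecidableEq S]

/-- The input data of a search: for the graph `G ↾ V`, the attractor to `T` of the owner of `O`
within `U ⊆ V`. -/
structure Spec (G : GameGraph S) (V U O T : Set S) (pred : S → List S) (deg : S → ℕ)
    (own within : S → Bool) : Prop where
  subset : U ⊆ V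
  nodup_pred : ∀ v ∈ U, (pred v).Nodup
  mem_pred : ∀ v ∈ U, ∀ u, u ∈ pred v ↔ u ∈ V ∧ (u, v) ∈ G.E
  within_iff : ∀ u ∈ V, within u = true ↔ u ∈ U
  own_iff : ∀ u, own u = true ↔ u ∈ O
  deg_pos : ∀ u ∈ U, u ∉ O → u ∉ T → 0 < deg u
  deg_eq : ∀ u ∈ U, u ∉ O → u ∉ T → deg u = {t | t ∈ U ∧ (u, t) ∈ G.E}.ncard

/-- The invariant of a search, where the states in `P` have been popped from the stack. -/
structure Inv (G : GameGraph S) (U O T : Set S) (deg : S → ℕ) (P : Finset S)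
    (σ : Search S) : Prop where
  nodup_found : σ.found.Nodup
  nodup_stack : σ.stack.Nodup
  mem_found : ∀ s, s ∈ σ.found ↔ s ∈ P ∨ s ∈ σ.stack
  disj : ∀ s ∈ P, s ∉ σ.stack
  mark_iff : ∀ s, σ.mark s = true ↔ s ∈ σ.found
  sound : ∀ s ∈ σ.found, G.Attr U O T s
  target : ∀ s ∈ U, s ∈ T → s ∈ σ.found
  hits_eq : ∀ u ∈ U, u ∉ O → σ.mark u = false →
    σ.hits u = (P.filter fun v => (u, v) ∈ G.E).card ∧ σ.hits u < deg u
  own_edge : ∀ u ∈ U, u ∈ O → σ.mark u = false → ∀ v ∈ P, (u, v) ∉ G.E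

variable {G : GameGraph S} {V U O T : Set S} {pred : S → List S} {deg : S → ℕ}
  {own within : S → Bool}

/-- Processing `v` inspects exactly the edges of `G ↾ V` into `v`, so a live counter grows by one
precisely when the state has an edge to the new element of `P`. Counters thus keep counting edges
into the popped states. -/
theorem Inv.step (h : Spec G V U O T pred deg own within) {P : Finset S} {σ : Search S}
    (I : Inv G U O T deg P σ) {v : S} {rest : List S} (hs : σ.stack = v :: rest) :
    v ∈ U ∧ v ∉ P ∧ Inv G U O T deg (insert v P)
      ((pred v).foldlM (inspect deg own within v) { σ with stack := rest }).val := by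
  have hvf : v ∈ σ.found := (I.mem_found v).2 (Or.inr (by simp [hs]))
  have hvA := I.sound v hvf
  have hvU : v ∈ U := hvA.mem
  have hvP : v ∉ P := fun hP => I.disj v hP (by simp [hs])
  have hnd := I.nodup_stack
  rw [hs, List.nodup_cons] at hnd
  refine ⟨hvU, hvP, ?_⟩
  rw [val_foldlM_inspect _ _ _ _ _ (h.nodup_pred v hvU)]
  have hnew : ∀ u, IsNew deg own within { σ with stack := rest } u ↔
      within u = true ∧ σ.mark u = false ∧ (own u = true ∨ σ.hits u + 1 = deg u) := fun u => Iff.rfl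
  have hunm : ∀ u, σ.mark u = false ↔ u ∉ σ.found := by
    intro u; rw [← I.mark_iff u]; simp
  have hmem : ∀ s, s ∈ σ.found ↔ s = v ∨ s ∈ P ∨ s ∈ rest := by
    intro s; rw [I.mem_found, hs]; simp; tauto
  have hfr : ∀ s, s ∈ rest → s ∈ σ.found := fun s hs' => (hmem s).2 (Or.inr (Or.inr hs'))
  have hfil : ∀ u, u ∈ U → u ∈ pred v → ((insert v P).filter fun t => (u, t) ∈ G.E).card =
      (P.filter fun t => (u, t) ∈ G.E).card + 1 := by
    intro u _ hup
    rw [Finset.filter_insert, if_pos ((h.mem_pred v hvU u).1 hup).2, Finset.card_insert_of_notMem]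
    simp [hvP]
  have hfil' : ∀ u, u ∈ U → u ∉ pred v → ((insert v P).filter fun t => (u, t) ∈ G.E) =
      (P.filter fun t => (u, t) ∈ G.E) := by
    intro u hu hup
    rw [Finset.filter_insert, if_neg]
    exact fun he => hup ((h.mem_pred v hvU u).2 ⟨h.subset hu, he⟩)
  constructor
  · refine List.Nodup.append ?_ I.nodup_found ?_
    · exact List.nodup_reverse.2 ((h.nodup_pred v hvU).filter _)
    · intro u hu hu'
      simp only [List.mem_reverse, List.mem_filter, decide_eq_true_eq, hnew] at hu
      exact (hunm u).1 hu.2.2.1 hu'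
  · refine List.Nodup.append ?_ hnd.2 ?_
    · exact List.nodup_reverse.2 ((h.nodup_pred v hvU).filter _)
    · intro u hu hu'
      simp only [List.mem_reverse, List.mem_filter, decide_eq_true_eq, hnew] at hu
      exact (hunm u).1 hu.2.2.1 (hfr u hu')
  · intro s
    simp only [List.mem_append, hmem, Finset.mem_insert]
    tauto
  · intro s hsP hss
    rw [List.mem_append] at hss
    rw [Finset.mem_insert] at hsP
    rcases hss with hss | hss
    · simp only [List.mem_reverse, List.mem_filter, decide_eq_true_eq, hnew] at hss
      exact (hunm s).1 hss.2.2.1 ((hmem s).2 (by tauto))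
    · rcases hsP with rfl | hsP
      · exact hnd.1 hss
      · exact I.disj s hsP (by simp [hs, hss])
  · intro s
    simp only [List.mem_append, List.mem_reverse, List.mem_filter, Bool.or_eq_true,
      decide_eq_true_eq, I.mark_iff]
    tauto
  · intro u hu
    simp only [List.mem_append, List.mem_reverse, List.mem_filter, decide_eq_true_eq] at hu
    rcases hu with ⟨hup, hn⟩ | hu
    · obtain ⟨huV, he⟩ := (h.mem_pred v hvU u).1 hup
      obtain ⟨hw, hm, ho⟩ := (hnew u).1 hn
      have huU : u ∈ U := (h.within_iff u huV).1 hw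
      by_cases huO : u ∈ O
      · exact .own huU huO he hvA
      · have hu1 : σ.hits u + 1 = deg u := ho.resolve_left fun h' => huO ((h.own_iff u).1 h')
        have huT : u ∉ T := fun hT => (hunm u).1 hm (I.target u huU hT)
        rw [(I.hits_eq u huU huO hm).1, ← hfil u huU hup, h.deg_eq u huU huO huT] at hu1
        refine .opp huU huO fun t ht hut => ?_
        have hPA : ∀ t ∈ insert v P, G.Attr U O T t := by
          intro t ht
          rw [Finset.mem_insert] at ht
          exact I.sound t ((hmem t).2 (by tauto))
        have hsub : {t | t ∈ U ∧ (u, t) ∈ G.E} ⊆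
            (G.E.image Prod.snd : Finset S) := by
          rintro t ⟨-, ht⟩
          simp only [Finset.coe_image, Set.mem_image, Finset.mem_coe]
          exact ⟨_, ht, rfl⟩
        -- The successors of `u` among the popped states all lie in `U`, and there are `deg u` of
        -- them, the number of all its successors in `U`. So every successor in `U` has been popped
        -- and is in the attractor.
        have heq := Set.eq_of_subset_of_ncard_le
          (s := (((insert v P).filter fun t => (u, t) ∈ G.E : Finset S) : Set S))
          (t := {t | t ∈ U ∧ (u, t) ∈ G.E})
          (by
            intro t ht
            simp only [Finset.coe_filter, Set.mem_ofPred_eq] at ht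
            exact ⟨(hPA t ht.1).mem, ht.2⟩)
          (by rw [Set.ncard_coe_finset]; exact hu1.ge)
          ((Finset.finite_toSet _).subset hsub)
        have : t ∈ {t | t ∈ U ∧ (u, t) ∈ G.E} := ⟨ht, hut⟩
        rw [← heq] at this
        simp only [Finset.coe_filter, Set.mem_ofPred_eq] at this
        exact hPA t this.1
    · exact I.sound u hu
  · intro s hsU hsT
    exact List.mem_append_right _ (I.target s hsU hsT)
  · intro u huU huO hm
    simp only [Bool.or_eq_false_iff, decide_eq_false_iff_not, hnew] at hm
    obtain ⟨hm, hn⟩ := hm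
    have hown : own u = false := by
      rw [← Bool.not_eq_true, h.own_iff]; exact huO
    have hw : within u = true := (h.within_iff u (h.subset huU)).2 huU
    obtain ⟨h1, h2⟩ := I.hits_eq u huU huO hm
    by_cases hup : u ∈ pred v
    · simp only [hup, hw, hm, hown, hfil u huU hup]
      -- As `u` stays unmarked, its increased counter is not `deg u`; together with the old strict
      -- inequality it stays below.
      simp only [hup, hw, hm, hown, true_and, Bool.false_eq_true, false_or] at hn
      simp only [Bool.not_false, Bool.and_self, and_self, if_true]
      omega
    · simp only [hup, hfil' u huU hup, false_and, if_false]
      exact ⟨h1, h2⟩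
  · intro u huU huO hm t ht he
    simp only [Bool.or_eq_false_iff, decide_eq_false_iff_not, hnew] at hm
    obtain ⟨hm, hn⟩ := hm
    rw [Finset.mem_insert] at ht
    rcases ht with rfl | ht
    · exact hn ⟨(h.mem_pred t hvU u).2 ⟨h.subset huU, he⟩,
        (h.within_iff u (h.subset huU)).2 huU, hm, Or.inl ((h.own_iff u).2 huO)⟩
    · exact I.own_edge u huU huO hm t ht he

/-- Each round moves a fresh state into `P`, which lets the round bound be compared with the number
of states. Rounds inspect edges with different targets, so no edge is paid twice and steps are
popped states plus inspected edges. -/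
theorem Inv.loop [Fintype S] (h : Spec G V U O T pred deg own within) (k : ℕ) {P : Finset S}
    {σ : Search S} (I : Inv G U O T deg P σ) (hk : Fintype.card S ≤ k + P.card) :
    ∃ P' : Finset S, P ⊆ P' ∧
      Inv G U O T deg P' (loop pred deg own within k σ).val ∧
      (loop pred deg own within k σ).val.stack = [] ∧
      (loop pred deg own within k σ).steps + P.card =
        P'.card + (loop pred deg own within k σ).edges.card ∧
      ∀ e, e ∈ (loop pred deg own within k σ).edges ↔ e.2 ∈ P' ∧ e.2 ∉ P ∧ e.1 ∈ V ∧ e ∈ G.E := by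
  induction k generalizing P σ with
  | zero =>
    -- If the round bound is used up, every state has been popped, and the stack, being disjoint
    -- from `P`, is empty anyway.
    have hP : P = Finset.univ := by
      rw [← Finset.card_eq_iff_eq_univ]
      exact le_antisymm (Finset.card_le_univ P) (by omega)
    refine ⟨P, subset_rfl, I, ?_, ?_, ?_⟩
    · rw [List.eq_nil_iff_forall_not_mem]
      intro s
      exact I.disj s (by simp [hP])
    · simp [Search.loop]
    · intro e
      simp only [Search.loop, Timed.edges_pure, Finset.notMem_empty, false_iff]
      tauto
  | succ k ih =>
    rw [Search.loop]
    split
    · rename_i hs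
      refine ⟨P, subset_rfl, I, hs, ?_, ?_⟩
      · simp
      · intro e
        simp only [Timed.edges_pure, Finset.notMem_empty, false_iff]
        tauto
    · rename_i v rest hs
      obtain ⟨hvU, hvP, I'⟩ := I.step h hs
      have hc := Finset.card_insert_of_notMem hvP
      obtain ⟨P', hPP, hI, hst, hsteps, hedges⟩ := ih I' (by omega)
      simp only [Timed.val_bind, Timed.steps_bind, Timed.edges_bind, Timed.steps_tick,
        Timed.edges_tick, Finset.empty_union,
        Timed.steps_foldlM (steps_inspect deg own within v),
        Timed.edges_foldlM (edges_inspect deg own within v)]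
      have hmem : ∀ e, e ∈ ((pred v).map fun u => (u, v)).toFinset ↔
          e.2 = v ∧ e.1 ∈ V ∧ e ∈ G.E := by
        rintro ⟨a, b⟩
        simp only [List.mem_toFinset, List.mem_map, Prod.mk.injEq]
        constructor
        · rintro ⟨u, hu, rfl, rfl⟩
          exact ⟨rfl, (h.mem_pred v hvU u).1 hu⟩
        · rintro ⟨rfl, hu⟩
          exact ⟨a, (h.mem_pred b hvU a).2 hu, rfl, rfl⟩
      refine ⟨P', (Finset.subset_insert v P).trans hPP, hI, hst, ?_, ?_⟩
      · rw [Finset.card_union_of_disjoint, List.toFinset_card_of_nodup, List.length_map]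
        · omega
        · exact (h.nodup_pred v hvU).map fun a b hab => (Prod.mk.inj hab).1
        · rw [Finset.disjoint_left]
          intro e he he'
          rw [hedges] at he'
          exact he'.2.1 (by simp [((hmem e).1 he).1])
      · intro e
        rw [Finset.mem_union, hmem, hedges, Finset.mem_insert]
        constructor
        · rintro (⟨h1, h2⟩ | h2)
          · rw [h1]
            exact ⟨hPP (Finset.mem_insert_self v P), hvP, h2⟩
          · tauto
        · tauto

/-- At the end the stack is empty, so found and popped states agree and the invariant says that the
found set is closed under the attractor rules. The edges inspected start anywhere in `V`, even for a
search within `U`: the predecessor lists used are those of the larger graph. -/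
theorem run_spec [Fintype S] (h : Spec G V U O T pred deg own within) {n : ℕ}
    (hn : Fintype.card S ≤ n) {target : List S} (hnd : target.Nodup)
    (ht : ∀ s, s ∈ target ↔ s ∈ U ∧ s ∈ T) :
    let r := run n pred deg own within target
    r.val.found.Nodup ∧ (∀ s, s ∈ r.val.found ↔ G.Attr U O T s) ∧
    (∀ s, r.val.mark s = true ↔ s ∈ r.val.found) ∧
    r.steps = 1 + target.length + r.val.found.length + r.edges.card ∧
    ∀ e, e ∈ r.edges ↔ e.2 ∈ r.val.found ∧ e.1 ∈ V ∧ e ∈ G.E := by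
  have hadd : ∀ (l : List S) (σ : Search S),
      l.foldl (fun σ v => σ.add v) σ =
        ⟨fun s => σ.mark s || decide (s ∈ l), σ.hits, l.reverse ++ σ.found,
          l.reverse ++ σ.stack⟩ := by
    intro l
    induction l with
    | nil => simp
    | cons x l ih =>
      intro σ
      rw [List.foldl_cons, ih]
      simp only [add, List.reverse_cons, List.append_assoc, List.singleton_append, Search.mk.injEq,
        and_true]
      funext s
      by_cases hs : s = x <;> simp [hs]
  have hval : (target.foldlM (fun (σ : Search S) v => (do
      Timed.tick
      return σ.add v : Timed S (Search S))) (empty : Search S)).val =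
      ⟨fun s => decide (s ∈ target), fun _ => 0, target.reverse, target.reverse⟩ := by
    rw [Timed.val_foldlM]
    simp only [Timed.val_bind, Timed.val_pure]
    rw [hadd]
    simp [empty]
  have I : Inv G U O T deg ∅
      ⟨fun s => decide (s ∈ target), fun _ => 0, target.reverse, target.reverse⟩ := by
    constructor <;> simp only [List.mem_reverse, List.nodup_reverse, decide_eq_true_eq,
      decide_eq_false_iff_not, Finset.notMem_empty, false_or, implies_true, Finset.filter_empty,
      Finset.card_empty, true_and, IsEmpty.forall_iff, hnd]
    · intro s hs
      exact .base ((ht s).1 hs).1 ((ht s).1 hs).2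
    · intro s h1 h2
      exact (ht s).2 ⟨h1, h2⟩
    -- Counters start at 0, so positivity of `deg` is needed: an opponent state with no successor in
    -- `U` belongs to the attractor vacuously, but would never be inspected.
    · intro u hu hO hm
      exact h.deg_pos u hu hO fun hT => hm ((ht u).2 ⟨hu, hT⟩)
  obtain ⟨P, -, hI, hst, hsteps, hedges⟩ := I.loop h n (by simpa using hn)
  have hfP : ∀ s, s ∈ (loop pred deg own within n
      ⟨fun s => decide (s ∈ target), fun _ => 0, target.reverse, target.reverse⟩).val.found ↔
      s ∈ P := by
    intro s
    rw [hI.mem_found, hst]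
    simp
  have hlen : (loop pred deg own within n
      ⟨fun s => decide (s ∈ target), fun _ => 0, target.reverse, target.reverse⟩).val.found.length =
      P.card := by
    rw [← List.toFinset_card_of_nodup hI.nodup_found]
    congr 1
    ext s
    rw [List.mem_toFinset, hfP]
  simp only [run, Timed.val_bind, Timed.steps_bind, Timed.edges_bind, hval, Timed.steps_tick,
    Timed.edges_tick, Finset.empty_union]
  rw [Timed.steps_foldlM (by simp), Timed.edges_foldlM_empty (by simp), Finset.empty_union]
  refine ⟨hI.nodup_found, fun s => ⟨hI.sound s, fun hA => ?_⟩, hI.mark_iff, ?_, ?_⟩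
  · induction hA with
    | base hU hT => exact hI.target _ hU hT
    | @own s t hU hO he _ ih =>
      by_contra hs
      rw [← hI.mark_iff, Bool.not_eq_true] at hs
      exact hI.own_edge s hU hO hs t ((hfP t).1 ih) he
    -- If all successors of `s` in `U` are found, hence popped, the counter of `s` is at least `deg
    -- s`, contradicting the strict bound for unmarked states.
    | @opp s hU hO _ ih =>
      by_contra hs
      have hsT : s ∉ T := fun hT => hs (hI.target s hU hT)
      rw [← hI.mark_iff, Bool.not_eq_true] at hs
      obtain ⟨h1, h2⟩ := hI.hits_eq s hU hO hs
      rw [h1, h.deg_eq s hU hO hsT, ← Set.ncard_coe_finset] at h2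
      refine absurd h2 (not_lt.2 (Set.ncard_le_ncard ?_ (Finset.finite_toSet _)))
      rintro t ⟨htU, hst'⟩
      simp only [Finset.coe_filter, Set.mem_ofPred_eq]
      exact ⟨(hfP t).1 (ih t htU hst'), hst'⟩
  · rw [hlen]
    simp only [Finset.card_empty] at hsteps
    omega
  · intro e
    rw [hedges, hfP]
    simp

end Search

/-! ### The two traps agree; counting edges and states over the iterations. -/

namespace GameGraph

section Sets

variable {S : Type u} (G : GameGraph S) (B : Finset S) (V : Set S)

theorem attr₁_subset (U : Set S) : G.attr₁ V U ⊆ V := fun _ h => h.mem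

theorem attr₂_subset (U : Set S) : G.attr₂ V U ⊆ V := fun _ h => h.mem

variable {G B V}

theorem notMem_of_mem_classicalTrap {s : S} (hs : s ∈ G.classicalTrap B V) : s ∉ B :=
  fun hB => hs.2 (.base hs.1 ⟨hB, hs.1⟩)

theorem succ_mem_classicalTrap {s t : S} (hs : s ∈ G.classicalTrap B V) (hs₁ : s ∈ G.S₁)
    (ht : t ∈ V) (he : (s, t) ∈ G.E) : t ∈ G.classicalTrap B V :=
  ⟨ht, fun h => hs.2 (.own hs.1 hs₁ he h)⟩

theorem exists_succ_mem_classicalTrap {s : S} (hs : s ∈ G.classicalTrap B V) (hs₁ : s ∉ G.S₁) :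
    ∃ t ∈ G.classicalTrap B V, (s, t) ∈ G.E := by
  by_contra! h
  refine hs.2 (.opp hs.1 hs₁ fun t ht he => ?_)
  by_contra hR
  exact h t ⟨ht, hR⟩ he

variable (G B V)

theorem cand_subset_X : G.C₁ B V ∪ G.C₂ B V ⊆ G.X B V := by
  rintro s hs
  exact .base (hs.elim (fun h => h.1) fun h => h.1) hs

theorem X_subset : G.X B V ⊆ V := G.attr₂_subset V _

theorem D_subset_X : G.D B V ⊆ G.X B V := by
  rintro s ((⟨-, h, -⟩ | ⟨-, h, -⟩) | h)
  exacts [h.1, h.1, h.1]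

/-- The conditions defining `C₁` and `C₂` ask to avoid `B` for one step; in the trap player 2 can do
this forever, so its states already satisfy them. -/
theorem classicalTrap_subset_Z : G.classicalTrap B V ⊆ G.Z B V := by
  intro s hs
  have hB := notMem_of_mem_classicalTrap hs
  refine ⟨cand_subset_X G B V ?_, hs.1, hB⟩
  by_cases hs₁ : s ∈ G.S₁
  · exact Or.inl ⟨hs.1, hB, hs₁, fun t ht he =>
      notMem_of_mem_classicalTrap (succ_mem_classicalTrap hs hs₁ ht he)⟩
  · obtain ⟨t, ht, he⟩ := exists_succ_mem_classicalTrap hs hs₁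
    exact Or.inr ⟨hs.1, hB, hs₁, t, ht.1, he, notMem_of_mem_classicalTrap ht⟩

/-- `L` is exactly the part of `X` that the classical attractor would reach, up to Büchi states:
each inclusion is an induction along one of the two attractors. -/
theorem altTrap_eq_classicalTrap : G.altTrap B V = G.classicalTrap B V := by
  have hTZ := G.classicalTrap_subset_Z B V
  apply subset_antisymm
  · rintro s ⟨hZ, hL⟩
    refine ⟨hZ.2.1, fun hR => ?_⟩
    -- Follow the attractor of `B` as long as it stays in `Z`. A player-1 step out of `Z` puts its
    -- source into `D`; for player 2 only successors in `X` matter, and those outside `Z` are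
    -- themselves in `D`.
    have key : ∀ s, G.Attr V (G.S₁ : Set S) ((B : Set S) ∩ V) s → s ∈ G.Z B V → s ∈ G.L B V := by
      intro s hs
      induction hs with
      | base _ hB => exact fun hZ => absurd hB.1 hZ.2.2
      | @own s t hV hs₁ he htA ih =>
        intro hZ
        by_cases ht : t ∈ G.Z B V
        · exact .own hZ.1 hs₁ he (ih ht)
        · exact .base hZ.1 (Or.inl (Or.inl ⟨hs₁, hZ, t, htA.mem, he, ht⟩))
      | @opp s hV hs₁ _ ih =>
        intro hZ
        refine .opp hZ.1 hs₁ fun t ht he => ?_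
        by_cases htZ : t ∈ G.Z B V
        · exact ih t (G.X_subset B V ht) he htZ
        · exact .base ht (Or.inr ⟨ht, htZ⟩)
    exact hL (key s hR hZ)
  · intro s hs
    refine ⟨hTZ hs, fun hL => ?_⟩
    -- The classical trap lies in `Z`, so its closure properties contradict every clause of `D`, and
    -- afterwards every attractor step.
    have key : ∀ s, G.Attr (G.X B V) (G.S₁ : Set S) (G.D B V) s → s ∉ G.classicalTrap B V := by
      intro s hs
      induction hs with
      | @base s _ hD =>
        rintro hT
        rcases hD with (⟨hs₁, -, t, ht, he, htZ⟩ | ⟨hs₁, -, h⟩) | h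
        · exact htZ (hTZ (succ_mem_classicalTrap hT hs₁ ht he))
        · obtain ⟨t, ht, he⟩ := exists_succ_mem_classicalTrap hT hs₁
          exact h t ht.1 he (hTZ ht)
        · exact h.2 (hTZ hT)
      | @own s t _ hs₁ he htA ih =>
        exact fun hT => ih (succ_mem_classicalTrap hT hs₁ (G.X_subset B V htA.mem) he)
      | @opp s _ hs₁ _ ih =>
        intro hT
        obtain ⟨t, ht, he⟩ := exists_succ_mem_classicalTrap hT hs₁
        exact ih t (hTZ ht).1 he ht
    exact key s hL hs

/-- Every state of `V` has a successor in `V`. -/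
def TotalOn : Prop := ∀ s ∈ V, ∃ t ∈ V, (s, t) ∈ G.E

variable {G V}

/-- A survivor all of whose successors were removed would itself have been attracted, whoever owns
it. -/
theorem TotalOn.diff_attr₂ (h : G.TotalOn V) (U : Set S) : G.TotalOn (V \ G.attr₂ V U) := by
  rintro s ⟨hV, hs⟩
  by_contra! hc
  refine hs ?_
  by_cases hs₁ : s ∈ G.S₁
  · refine .opp hV (fun h => h hs₁) fun t ht he => ?_
    by_contra hA
    exact hc t ⟨ht, hA⟩ he
  · obtain ⟨t, ht, he⟩ := h s hV
    refine .own hV hs₁ he ?_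
    by_contra hA
    exact hc t ⟨ht, hA⟩ he

theorem TotalOn.stateSeq (trap : Set S → Set S) (i : ℕ) : G.TotalOn (G.stateSeq trap i) := by
  induction i with
  | zero => exact fun s _ => (G.total s).imp fun t ht => ⟨trivial, ht⟩
  | succ i ih => exact ih.diff_attr₂ _

/-- Used to charge each removed state to an edge entering the removed set. For states of the target
this depends on the target being a trap: play can remain in it. -/
theorem TotalOn.exists_succ_mem_attr₂ (h : G.TotalOn V) {s : S}
    (hs : s ∈ G.attr₂ V (G.classicalTrap B V)) :
    ∃ t ∈ G.attr₂ V (G.classicalTrap B V), (s, t) ∈ G.E := by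
  cases hs with
  | base hV hT =>
    by_cases hs₁ : s ∈ G.S₁
    · obtain ⟨t, ht, he⟩ := h s hV
      exact ⟨t, .base ht (succ_mem_classicalTrap hT hs₁ ht he), he⟩
    · obtain ⟨t, ht, he⟩ := exists_succ_mem_classicalTrap hT hs₁
      exact ⟨t, .base ht.1 ht, he⟩
  | @own _ t _ _ he ht => exact ⟨t, ht, he⟩
  | opp hV _ hA =>
    obtain ⟨t, ht, he⟩ := h s hV
    exact ⟨t, hA t ht he, he⟩

variable (G V)

/-- The edges of `G ↾ V` that enter `W`. -/
def edgesInto (W : Set S) : Set (S × S) := {e | e.2 ∈ W ∧ e.1 ∈ V ∧ e.2 ∈ V ∧ e ∈ G.E}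

/-- The edges of `G ↾ V` that leave a state of `W`. -/
def edgesFrom (W : Set S) : Set (S × S) := {e | e.1 ∈ W ∧ e.1 ∈ V ∧ e.2 ∈ V ∧ e ∈ G.E}

/-- The edges of `G ↾ V`. -/
def edgesOn : Set (S × S) := {e | e.1 ∈ V ∧ e.2 ∈ V ∧ e ∈ G.E}

theorem edgesInto_trap_subset {V : Set S} (T : Set S) (hT : T ⊆ V) :
    {e : S × S | e ∈ G.E ∧ e.1 ∈ V ∧ e.2 ∈ T} ⊆
      G.edgesInto V (G.attr₂ V T) := by
  rintro e ⟨h1, h2, h3⟩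
  exact ⟨.base (hT h3) h3, h2, hT h3, h1⟩

variable [Fintype S]

theorem ncard_edgesOn_diff {W : Set S} :
    (G.edgesOn (V \ W)).ncard + (G.edgesInto V W ∪ G.edgesFrom V W).ncard =
      (G.edgesOn V).ncard := by
  rw [← Set.ncard_union_eq]
  · congr 1
    ext e
    simp only [edgesOn, edgesInto, edgesFrom, Set.mem_union, Set.mem_ofPred_eq, Set.mem_sdiff]
    tauto
  · rw [Set.disjoint_left]
    intro e
    simp only [edgesOn, edgesInto, edgesFrom, Set.mem_union, Set.mem_ofPred_eq, Set.mem_sdiff]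
    tauto

variable (trap : Set S → Set S)

/-- The sum telescopes: an edge of the current graph either survives or touches the removed set, so
it is counted in one iteration only. -/
theorem sum_ncard_edges_add (k : ℕ) :
    ∑ i ∈ Finset.range k,
      (G.edgesInto (G.stateSeq trap i) (G.attr₂ (G.stateSeq trap i) (trap (G.stateSeq trap i))) ∪
      G.edgesFrom (G.stateSeq trap i) (G.attr₂ (G.stateSeq trap i) (trap (G.stateSeq trap i)))).ncard
      + (G.edgesOn (G.stateSeq trap k)).ncard = G.E.card := by
  induction k with
  | zero =>
    rw [← Set.ncard_coe_finset G.E]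
    simp [edgesOn, stateSeq]
  | succ k ih =>
    rw [Finset.sum_range_succ, ← ih, ← G.ncard_edgesOn_diff (G.stateSeq trap k)
      (W := G.attr₂ (G.stateSeq trap k) (trap (G.stateSeq trap k)))]
    simp only [stateSeq]
    omega

theorem sum_ncard_attr₂_add (k : ℕ) :
    ∑ i ∈ Finset.range k, (G.attr₂ (G.stateSeq trap i) (trap (G.stateSeq trap i))).ncard
      + (G.stateSeq trap k).ncard = Fintype.card S := by
  induction k with
  | zero => simp [stateSeq, Set.ncard_univ]
  | succ k ih =>
    rw [Finset.sum_range_succ, ← ih]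
    simp only [stateSeq]
    rw [← Set.ncard_sdiff_add_ncard_of_subset (G.attr₂_subset (G.stateSeq trap k)
      (trap (G.stateSeq trap k)))]
    omega

theorem card_le_card_edges : Fintype.card S ≤ G.E.card := by
  classical
  have : (Finset.univ : Finset S) ⊆ G.E.image Prod.fst := by
    intro s _
    obtain ⟨t, ht⟩ := G.total s
    exact Finset.mem_image.2 ⟨_, ht, rfl⟩
  exact (Finset.card_le_card this).trans Finset.card_image_le

/-- The charging device behind all comparisons of steps with work: a state pays with one of its
outgoing edges, and different sources give different edges. -/
theorem ncard_le_of_forall_exists_edge {W : Set S} {F : Set (S × S)}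
    (h : ∀ s ∈ W, ∃ t, (s, t) ∈ F) : W.ncard ≤ F.ncard := by
  have : W ⊆ Prod.fst '' F := fun s hs => (h s hs).elim fun t ht => ⟨_, ht, rfl⟩
  exact (Set.ncard_le_ncard this).trans (Set.ncard_image_le)

end Sets

/-! ### Adjacency lists of `G ↾ V` and the deletion of one state. -/

section Lists

variable {S : Type u}

/-- The lists and the out-degrees represent `G ↾ V`. -/
structure IsListed (G : GameGraph S) (V : Set S) (succ pred : S → List S) (deg : S → ℕ) : Prop where
  nodup_succ : ∀ s ∈ V, (succ s).Nodup
  mem_succ : ∀ s ∈ V, ∀ t, t ∈ succ s ↔ t ∈ V ∧ (s, t) ∈ G.E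
  nodup_pred : ∀ s ∈ V, (pred s).Nodup
  mem_pred : ∀ t ∈ V, ∀ s, s ∈ pred t ↔ s ∈ V ∧ (s, t) ∈ G.E
  deg_eq : ∀ s ∈ V, deg s = (succ s).length

variable {G : GameGraph S} {V : Set S} {succ pred : S → List S} {deg : S → ℕ}

theorem IsListed.deg_pos (h : G.IsListed V succ pred deg) (ht : G.TotalOn V) {s : S} (hs : s ∈ V) :
    0 < deg s := by
  obtain ⟨t, htV, he⟩ := ht s hs
  rw [h.deg_eq s hs]
  exact List.length_pos_of_mem ((h.mem_succ s hs t).2 ⟨htV, he⟩)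

variable [DecidableEq S]

theorem _root_.List.Nodup.length_eq_ncard {l : List S} (hl : l.Nodup) {W : Set S}
    (h : ∀ s, s ∈ l ↔ s ∈ W) : l.length = W.ncard := by
  rw [← List.toFinset_card_of_nodup hl, ← Set.ncard_coe_finset]
  congr 1
  ext s
  simp [h]

theorem _root_.Finset.card_eq_ncard {α : Type*} {F : Finset α} {W : Set α}
    (h : ∀ s, s ∈ F ↔ s ∈ W) : F.card = W.ncard := by
  rw [← Set.ncard_coe_finset]
  congr 1
  ext s
  simp [h]

theorem IsListed.spec (h : G.IsListed V succ pred deg) (ht : G.TotalOn V) {O T : Set S}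
    {own : S → Bool} (hO : ∀ u, own u = true ↔ u ∈ O) :
    Search.Spec G V V O T pred deg own fun _ => true where
  subset := subset_rfl
  nodup_pred := h.nodup_pred
  mem_pred := h.mem_pred
  within_iff := by simp
  own_iff := hO
  deg_pos := fun u hu _ _ => h.deg_pos ht hu
  deg_eq := fun u hu _ _ => by
    rw [h.deg_eq u hu]
    exact (h.nodup_succ u hu).length_eq_ncard (h.mem_succ u hu)

theorem IsListed.removable_spec [Fintype S] (h : G.IsListed V succ pred deg) (ht : G.TotalOn V)
    {n : ℕ} (hn : Fintype.card S ≤ n) {T : Set S} {tr : List S} (hnd : tr.Nodup)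
    (htr : ∀ s, s ∈ tr ↔ s ∈ T) (hT : T ⊆ V) :
    let r := G.removable n pred deg tr
    r.val.Nodup ∧ (∀ s, s ∈ r.val ↔ s ∈ G.attr₂ V T) ∧
    r.edges.card = (G.edgesInto V (G.attr₂ V T)).ncard ∧
    r.steps = 1 + T.ncard + (G.attr₂ V T).ncard + (G.edgesInto V (G.attr₂ V T)).ncard := by
  obtain ⟨h1, h2, -, h4, h5⟩ := Search.run_spec (O := (G.S₁ : Set S)ᶜ) (T := T)
    (own := fun s => s ∉ G.S₁) (h.spec ht (by simp)) hn hnd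
    (fun s => (htr s).trans ⟨fun h => ⟨hT h, h⟩, fun h => h.2⟩)
  have hc := Finset.card_eq_ncard (W := G.edgesInto V (G.attr₂ V T)) (fun e => by
    rw [h5, h2]
    exact ⟨fun he => ⟨he.1, he.2.1, he.1.mem, he.2.2⟩, fun he => ⟨he.1, he.2.1, he.2.2.2⟩⟩)
  simp only [removable, Timed.val_bind, Timed.edges_bind, Timed.steps_bind, Timed.val_pure,
    Timed.edges_pure, Timed.steps_pure, Finset.union_empty, add_zero]
  refine ⟨h1, h2, hc, ?_⟩
  rw [h4, hc, hnd.length_eq_ncard htr, h1.length_eq_ncard h2]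
  rfl

/-- The predecessor lists without the state `v`. -/
def predErase (succ pred : S → List S) (v x : S) : List S :=
  if x ∈ succ v then (pred x).erase v else pred x

/-- The edges inspected when `v` is removed. -/
def eraseEdges (succ pred : S → List S) (v : S) : Finset (S × S) :=
  ((succ v).map fun t => (v, t)).toFinset ∪ ((predErase succ pred v v).map fun u => (u, v)).toFinset

theorem IsListed.nodup_predErase (h : G.IsListed V succ pred deg) (v : S) {x : S} (hx : x ∈ V) :
    (predErase succ pred v x).Nodup := by
  unfold predErase
  split_ifs
  exacts [(h.nodup_pred x hx).erase v, h.nodup_pred x hx]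

theorem IsListed.mem_predErase (h : G.IsListed V succ pred deg) {v : S} (hv : v ∈ V) {x : S}
    (hx : x ∈ V) (u : S) : u ∈ predErase succ pred v x ↔ u ≠ v ∧ u ∈ V ∧ (u, x) ∈ G.E := by
  unfold predErase
  split_ifs with hs
  · rw [(h.nodup_pred x hx).mem_erase_iff, h.mem_pred x hx]
  · rw [h.mem_pred x hx]
    refine ⟨fun hu => ⟨?_, hu⟩, fun hu => hu.2⟩
    rintro rfl
    exact hs ((h.mem_succ u hv x).2 ⟨hx, hu.2⟩)

theorem IsListed.erase (h : G.IsListed V succ pred deg) {v : S} (hv : v ∈ V) :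
    G.IsListed (V \ {v})
      (fun u => if u ∈ predErase succ pred v v then (succ u).erase v else succ u)
      (predErase succ pred v)
      (fun u => if u ∈ predErase succ pred v v then deg u - 1 else deg u) where
  nodup_succ := by
    rintro s ⟨hs, -⟩
    split_ifs
    exacts [(h.nodup_succ s hs).erase v, h.nodup_succ s hs]
  mem_succ := by
    rintro s ⟨hs, hsv⟩ t
    split_ifs with hp <;> rw [h.mem_predErase hv hv] at hp
    · rw [(h.nodup_succ s hs).mem_erase_iff, h.mem_succ s hs, Set.mem_sdiff, Set.mem_singleton_iff]
      tauto
    · rw [h.mem_succ s hs, Set.mem_sdiff, Set.mem_singleton_iff]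
      refine ⟨fun ht => ⟨⟨ht.1, ?_⟩, ht.2⟩, fun ht => ⟨ht.1.1, ht.2⟩⟩
      rintro rfl
      exact hp ⟨hsv, hs, ht.2⟩
  nodup_pred := fun s hs => h.nodup_predErase v hs.1
  mem_pred := by
    rintro t ⟨ht, -⟩ s
    rw [h.mem_predErase hv ht, Set.mem_sdiff, Set.mem_singleton_iff]
    tauto
  deg_eq := by
    rintro s ⟨hs, hsv⟩
    split_ifs with hp
    · have := (h.mem_predErase hv hv s).1 hp
      rw [List.length_erase_of_mem ((h.mem_succ s hs v).2 ⟨hv, this.2.2⟩), h.deg_eq s hs]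
    · exact h.deg_eq s hs

theorem IsListed.mem_eraseEdges (h : G.IsListed V succ pred deg) {v : S} (hv : v ∈ V) (e : S × S) :
    e ∈ eraseEdges succ pred v ↔ (e.1 = v ∨ e.2 = v) ∧ e.1 ∈ V ∧ e.2 ∈ V ∧ e ∈ G.E := by
  obtain ⟨a, b⟩ := e
  simp only [eraseEdges, Finset.mem_union, List.mem_toFinset, List.mem_map, Prod.mk.injEq,
    h.mem_succ v hv, h.mem_predErase hv hv]
  constructor
  · rintro (⟨t, ht, rfl, rfl⟩ | ⟨u, hu, rfl, rfl⟩)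
    exacts [⟨Or.inl rfl, hv, ht⟩, ⟨Or.inr rfl, hu.2.1, hv, hu.2.2⟩]
  · rintro ⟨hab, ha, hb, he⟩
    by_cases hav : a = v
    · subst hav
      exact Or.inl ⟨b, ⟨hb, he⟩, rfl, rfl⟩
    · have := hab.resolve_left hav
      subst this
      exact Or.inr ⟨a, ⟨hav, ha, he⟩, rfl, rfl⟩

/-- A self-loop at `v` is counted once: the pass over the successors of `v` has already deleted `v`
from its own predecessor list when that list is scanned. -/
theorem IsListed.card_eraseEdges (h : G.IsListed V succ pred deg) {v : S} (hv : v ∈ V) :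
    (eraseEdges succ pred v).card = (succ v).length + (predErase succ pred v v).length := by
  rw [eraseEdges, Finset.card_union_of_disjoint, List.toFinset_card_of_nodup,
    List.toFinset_card_of_nodup, List.length_map, List.length_map]
  · exact (h.nodup_predErase v hv).map fun a b hab => (Prod.mk.inj hab).1
  · exact (h.nodup_succ v hv).map fun a b hab => (Prod.mk.inj hab).2
  · rw [Finset.disjoint_left]
    simp only [List.mem_toFinset, List.mem_map, not_exists, not_and, forall_exists_index, and_imp]
    rintro e t _ rfl u hu he
    obtain ⟨rfl, -⟩ := Prod.mk.inj he
    exact ((h.mem_predErase hv hv u).1 hu).1 rfl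

end Lists

end GameGraph

/-! ### The classical program: sets and costs of each iteration. -/

namespace GameGraph

variable {S : Type u} {G : GameGraph S} {B : Finset S} {V : Set S}

/-- The costs of computing and of removing `Attr₂(T, G ↾ V)`. -/
structure RemovalCosts (G : GameGraph S) (V T : Set S) (attr remove : Cost) : Prop where
  attr_work : attr.work = (G.edgesInto V (G.attr₂ V T)).ncard
  attr_steps : attr.steps = 1 + T.ncard + (G.attr₂ V T).ncard + attr.work
  remove_work : remove.work =
    (G.edgesInto V (G.attr₂ V T) ∪ G.edgesFrom V (G.attr₂ V T)).ncard
  remove_steps : remove.steps = (G.attr₂ V T).ncard + remove.work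

theorem AdjList.isListed (A : G.AdjList) :
    G.IsListed Set.univ A.succ A.pred fun s => (A.succ s).length where
  nodup_succ := fun s _ => A.nodup_succ s
  mem_succ := fun s _ t => by simp [A.mem_succ]
  nodup_pred := fun s _ => A.nodup_pred s
  mem_pred := fun t _ s => by simp [A.mem_pred]
  deg_eq := fun _ _ => rfl

variable [DecidableEq S]

/-- A fold over states all of whose outgoing edges are inspected. -/
theorem AdjList.cost_foldlM {α : Type v} (A : G.AdjList) {f : α → S → Timed S α}
    (hs : ∀ a s, (f a s).steps = 1 + (A.succ s).length)
    (he : ∀ a s, (f a s).edges = ((A.succ s).map fun t => (s, t)).toFinset) (a : α) :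
    (A.states.foldlM f a).edges.card = G.E.card ∧
    (A.states.foldlM f a).steps = A.states.length + G.E.card := by
  have key : ∀ l : List S, l.Nodup → ∀ a,
      (l.foldlM f a).steps = l.length + (l.foldlM f a).edges.card ∧
      ∀ e, e ∈ (l.foldlM f a).edges ↔ e.1 ∈ l ∧ e ∈ G.E := by
    intro l
    induction l with
    | nil => intro _ a; simp
    | cons x l ih =>
      intro hl a
      obtain ⟨hx, hl⟩ := List.nodup_cons.1 hl
      obtain ⟨h1, h2⟩ := ih hl (f a x).val
      have hm : ∀ e, e ∈ (f a x).edges ↔ e.1 = x ∧ e ∈ G.E := by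
        rintro ⟨p, q⟩
        rw [he]
        simp only [List.mem_toFinset, List.mem_map, Prod.mk.injEq, A.mem_succ]
        constructor
        · rintro ⟨t, ht, rfl, rfl⟩; exact ⟨rfl, ht⟩
        · rintro ⟨rfl, ht⟩; exact ⟨q, ht, rfl, rfl⟩
      simp only [List.foldlM_cons, Timed.steps_bind, Timed.edges_bind]
      constructor
      · rw [Finset.card_union_of_disjoint, hs, h1, he, List.toFinset_card_of_nodup, List.length_map,
          List.length_cons]
        · omega
        · exact (A.nodup_succ x).map fun a b hab => (Prod.mk.inj hab).2
        · rw [Finset.disjoint_left]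
          intro e hex hel
          exact hx (((hm e).1 hex).1 ▸ ((h2 e).1 hel).1)
      · intro e
        rw [Finset.mem_union, hm, h2, List.mem_cons]
        tauto
  obtain ⟨h1, h2⟩ := key _ A.nodup_states a
  have : (A.states.foldlM f a).edges = G.E := by
    ext e; simp [h2, A.mem_states]
  rw [h1, this]
  exact ⟨rfl, rfl⟩

/-- The memory of the classical algorithm represents `G ↾ V`. -/
structure CMem.Represents (G : GameGraph S) (B : Finset S) (V : Set S) (c : CMem S) : Prop where
  listed : G.IsListed V c.succ c.pred c.deg
  nodup_states : c.states.Nodup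
  mem_states : ∀ s, s ∈ c.states ↔ s ∈ V
  nodup_buchi : c.buchi.Nodup
  mem_buchi : ∀ s, s ∈ c.buchi ↔ s ∈ V ∧ s ∈ B

theorem AdjList.cInit_spec (A : G.AdjList) (B : Finset S) :
    CMem.Represents G B Set.univ (A.cInit B).val ∧ (A.cInit B).edges.card = G.E.card ∧
    (A.cInit B).steps = A.states.length + G.E.card := by
  have hcount : ∀ (s : S) (l : List S) (k : ℕ), (l.foldlM (fun (k : ULift.{u} ℕ) t => (do
      Timed.visit (s, t)
      return ULift.up (k.down + 1) : Timed S (ULift.{u} ℕ))) (ULift.up k)).val.down =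
      k + l.length := by
    intro s l
    induction l with
    | nil => simp
    | cons x l ih =>
      intro k
      rw [List.foldlM_cons, Timed.val_bind]
      exact (ih (k + 1)).trans (by simp; omega)
  have hfold : ∀ (l : List S) (c : CMem S), l.foldl (fun c s =>
      { c with
        deg := Function.update c.deg s (A.succ s).length
        buchi := if s ∈ B then s :: c.buchi else c.buchi }) c =
      { c with
        deg := fun s => if s ∈ l then (A.succ s).length else c.deg s
        buchi := (l.filter (· ∈ B)).reverse ++ c.buchi } := by
    intro l
    induction l with
    | nil => simp
    | cons x l ih =>
      intro c
      rw [List.foldl_cons, ih]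
      simp only [CMem.mk.injEq, true_and]
      constructor
      · funext s
        by_cases hs : s = x
        · subst hs; simp
        · simp [hs]
      · by_cases hx : x ∈ B <;> simp [hx]
  have hval : (A.cInit B).val = ⟨A.succ, A.pred, fun s => (A.succ s).length, A.states,
      (A.states.filter (· ∈ B)).reverse⟩ := by
    rw [cInit, Timed.val_foldlM]
    simp only [Timed.val_bind, Timed.val_pure, hcount, zero_add]
    rw [hfold]
    simp [A.mem_states]
  refine ⟨?_, A.cost_foldlM ?_ ?_ _⟩
  · rw [hval]
    constructor
    · exact A.isListed
    · exact A.nodup_states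
    · simp [A.mem_states]
    · exact List.nodup_reverse.2 (A.nodup_states.filter _)
    · simp [A.mem_states]
  · intro c s
    simp only [Timed.steps_bind, Timed.steps_tick, Timed.steps_pure, add_zero]
    rw [Timed.steps_foldlM (by simp)]
  · intro c s
    simp only [Timed.edges_bind, Timed.edges_tick, Timed.edges_pure, Finset.union_empty,
      Finset.empty_union]
    rw [Timed.edges_foldlM (h := fun t => (s, t)) (by simp)]

theorem CMem.Represents.cTrap_spec [Fintype S] {c : CMem S} (h : c.Represents G B V)
    (ht : G.TotalOn V) {n : ℕ} (hn : Fintype.card S ≤ n) :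
    let r := G.cTrap n c
    (∀ s, s ∈ r.val.1 ↔ s ∈ G.reachSet B V) ∧
    r.val.2.Nodup ∧ (∀ s, s ∈ r.val.2 ↔ s ∈ G.classicalTrap B V) ∧
    r.edges.card = (G.edgesInto V (G.reachSet B V)).ncard ∧
    1 + r.edges.card ≤ r.steps ∧ r.steps ≤ 1 + 3 * V.ncard + r.edges.card := by
  obtain ⟨h1, h2, h3, h4, h5⟩ := Search.run_spec (O := (G.S₁ : Set S)) (T := (B : Set S) ∩ V)
    (own := fun s => s ∈ G.S₁) (h.listed.spec ht (by simp)) hn h.nodup_buchi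
    (fun s => (h.mem_buchi s).trans ⟨fun h => ⟨h.1, h.2, h.1⟩, fun h => ⟨h.1, h.2.1⟩⟩)
  simp only [cTrap, Timed.val_bind, Timed.edges_bind, Timed.steps_bind, Timed.val_pure,
    Timed.edges_pure, Timed.steps_pure, Finset.union_empty, add_zero, Timed.edges_select,
    Timed.steps_select, Timed.val_select]
  refine ⟨h2, List.nodup_reverse.2 (h.nodup_states.filter _), ?_, ?_, ?_, ?_⟩
  · intro s
    simp only [List.mem_reverse, List.mem_filter, h.mem_states, Bool.not_eq_true',
      ← Bool.not_eq_true, h3, h2]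
    rfl
  · refine Finset.card_eq_ncard fun e => ?_
    rw [h5, h2]
    exact ⟨fun he => ⟨he.1, he.2.1, he.1.mem, he.2.2⟩, fun he => ⟨he.1, he.2.1, he.2.2.2⟩⟩
  · omega
  -- The three multiples of `|V|` pay for loading the Büchi states, for popping the found states and
  -- for scanning the list of all states.
  · have hb : c.buchi.length ≤ V.ncard := by
      rw [h.nodup_buchi.length_eq_ncard (W := V ∩ B) h.mem_buchi]
      exact Set.ncard_le_ncard Set.inter_subset_left
    have hf : (Search.run n c.pred c.deg (fun s => s ∈ G.S₁) (fun _ => true)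
        c.buchi).val.found.length ≤ V.ncard := by
      rw [h1.length_eq_ncard (W := G.reachSet B V) h2]
      exact Set.ncard_le_ncard (G.attr₁_subset V _)
    rw [h4, h.nodup_states.length_eq_ncard h.mem_states]
    omega

/-- Deleting one state leaves a memory for a smaller `V`, so the induction shrinks `V` along with
`w`. Edges already deleted are absent from the smaller graph, hence each edge is paid once and the
step count is exact. -/
theorem CMem.Represents.cRemove_spec {w : List S} (hw : w.Nodup) {c : CMem S}
    (h : c.Represents G B V) (hwV : ∀ s ∈ w, s ∈ V) :
    (cRemove w c).val.Represents G B (V \ {s | s ∈ w}) ∧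
    (cRemove w c).steps = w.length + (cRemove w c).edges.card ∧
    ∀ e, e ∈ (cRemove w c).edges ↔
      e ∈ G.edgesInto V {s | s ∈ w} ∪ G.edgesFrom V {s | s ∈ w} := by
  have hfold₁ : ∀ (v : S) (l : List S), l.Nodup → ∀ c : CMem S, l.foldl (fun c t =>
      { c with pred := Function.update c.pred t ((c.pred t).erase v) }) c =
      { c with pred := fun x => if x ∈ l then (c.pred x).erase v else c.pred x } := by
    intro v l
    induction l with
    | nil => simp
    | cons x l ih =>
      intro hl c
      obtain ⟨hx, hl⟩ := List.nodup_cons.1 hl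
      rw [List.foldl_cons, ih hl]
      simp only [CMem.mk.injEq, true_and, and_true]
      funext s
      by_cases hs : s = x
      · subst hs; simp [hx]
      · simp [hs]
  have hfold₂ : ∀ (v : S) (l : List S), l.Nodup → ∀ c : CMem S, l.foldl (fun c u =>
      { c with
        succ := Function.update c.succ u ((c.succ u).erase v)
        deg := Function.update c.deg u (c.deg u - 1) }) c =
      { c with
        succ := fun u => if u ∈ l then (c.succ u).erase v else c.succ u
        deg := fun u => if u ∈ l then c.deg u - 1 else c.deg u } := by
    intro v l
    induction l with
    | nil => simp
    | cons x l ih =>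
      intro hl c
      obtain ⟨hx, hl⟩ := List.nodup_cons.1 hl
      rw [List.foldl_cons, ih hl]
      simp only [CMem.mk.injEq, true_and, and_true]
      constructor <;>
      · funext s
        by_cases hs : s = x
        · subst hs; simp [hx]
        · simp [hs]
  induction w generalizing c V with
  | nil => simpa [cRemove, edgesInto, edgesFrom] using h
  | cons v w ih =>
    obtain ⟨hv, hw⟩ := List.nodup_cons.1 hw
    have hvV : v ∈ V := hwV v (by simp)
    have hnp := h.listed.nodup_predErase v hvV
    have hc' : CMem.Represents G B (V \ {v})
        ⟨fun u => if u ∈ predErase c.succ c.pred v v then (c.succ u).erase v else c.succ u,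
          predErase c.succ c.pred v,
          fun u => if u ∈ predErase c.succ c.pred v v then c.deg u - 1 else c.deg u,
          c.states.erase v, c.buchi.erase v⟩ := by
      constructor
      · exact h.listed.erase hvV
      · exact h.nodup_states.erase v
      · intro s
        rw [h.nodup_states.mem_erase_iff, h.mem_states, Set.mem_sdiff, Set.mem_singleton_iff,
          and_comm]
      · exact h.nodup_buchi.erase v
      · intro s
        rw [h.nodup_buchi.mem_erase_iff, h.mem_buchi, Set.mem_sdiff, Set.mem_singleton_iff]
        tauto
    obtain ⟨i1, i2, i3⟩ := ih hw hc' fun s hs => ⟨hwV s (by simp [hs]), fun hsv => hv (hsv ▸ hs)⟩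
    have hval : (cRemove (v :: w) c).val = (cRemove w
        ⟨fun u => if u ∈ predErase c.succ c.pred v v then (c.succ u).erase v else c.succ u,
          predErase c.succ c.pred v,
          fun u => if u ∈ predErase c.succ c.pred v v then c.deg u - 1 else c.deg u,
          c.states.erase v, c.buchi.erase v⟩).val ∧
        (cRemove (v :: w) c).steps = 1 + ((c.succ v).length + (predErase c.succ c.pred v v).length)
          + (cRemove w
        ⟨fun u => if u ∈ predErase c.succ c.pred v v then (c.succ u).erase v else c.succ u,
          predErase c.succ c.pred v,
          fun u => if u ∈ predErase c.succ c.pred v v then c.deg u - 1 else c.deg u,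
          c.states.erase v, c.buchi.erase v⟩).steps ∧
        (cRemove (v :: w) c).edges = eraseEdges c.succ c.pred v ∪ (cRemove w
        ⟨fun u => if u ∈ predErase c.succ c.pred v v then (c.succ u).erase v else c.succ u,
          predErase c.succ c.pred v,
          fun u => if u ∈ predErase c.succ c.pred v v then c.deg u - 1 else c.deg u,
          c.states.erase v, c.buchi.erase v⟩).edges := by
      unfold cRemove
      rw [List.foldlM_cons]
      simp only [Timed.val_bind, Timed.steps_bind, Timed.edges_bind, Timed.val_foldlM,
        Timed.val_pure]
      rw [hfold₁ v _ (h.listed.nodup_succ v hvV), hfold₂ v _ (by exact hnp)]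
      refine ⟨rfl, ?_, ?_⟩
      · rw [Timed.steps_foldlM (by simp), Timed.steps_foldlM (by simp)]
        simp only [Timed.steps_tick, predErase]
        congr 1
      · rw [Timed.edges_foldlM (h := fun t => (v, t)) (by simp),
          Timed.edges_foldlM (h := fun u => (u, v)) (by simp), Timed.edges_tick,
          Finset.empty_union]
        rfl
    obtain ⟨hval, hsteps, hedges⟩ := hval
    have hmem := h.listed.mem_eraseEdges hvV
    refine ⟨?_, ?_, ?_⟩
    · rw [hval]
      convert i1 using 1
      ext s
      simp only [Set.mem_sdiff, Set.mem_ofPred_eq, List.mem_cons, Set.mem_singleton_iff]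
      tauto
    · rw [hsteps, hedges, Finset.card_union_of_disjoint, i2, List.length_cons,
        h.listed.card_eraseEdges hvV]
      · omega
      · rw [Finset.disjoint_left]
        intro e he he'
        rw [hmem] at he
        rw [i3] at he'
        simp only [edgesInto, edgesFrom, Set.mem_union, Set.mem_ofPred_eq, Set.mem_sdiff,
          Set.mem_singleton_iff] at he'
        tauto
    · intro e
      rw [hedges, Finset.mem_union, hmem, i3]
      simp only [edgesInto, edgesFrom, Set.mem_union, Set.mem_ofPred_eq, Set.mem_sdiff,
        Set.mem_singleton_iff, List.mem_cons]
      by_cases h1 : e.1 = v <;> by_cases h2 : e.2 = v <;> simp only [h1, h2] <;> tauto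

/-- What the record of an iteration of the classical algorithm on `G ↾ V` says. -/
structure CIter.Describes (G : GameGraph S) (B : Finset S) (V : Set S) (a : CIter S) : Prop where
  reach : ∀ s, s ∈ a.reach ↔ s ∈ G.reachSet B V
  trap : ∀ s, s ∈ a.trap ↔ s ∈ G.classicalTrap B V
  removed : ∀ s, s ∈ a.removed ↔ s ∈ G.attr₂ V (G.classicalTrap B V)
  trap_work : a.trapCost.work = (G.edgesInto V (G.reachSet B V)).ncard
  lt_trap_steps : 1 + a.trapCost.work ≤ a.trapCost.steps
  trap_steps_le : a.trapCost.steps ≤ 1 + 3 * V.ncard + a.trapCost.work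
  costs : RemovalCosts G V (G.classicalTrap B V) a.attrCost a.removeCost

/-- The iteration bound `k` exceeds the number of remaining states, and a nonempty removal strictly
lowers that number; so the loop can end only through an empty removal. -/
theorem cLoop_spec [Fintype S] {n : ℕ} (hn : Fintype.card S ≤ n) (k j : ℕ) {c : CMem S}
    (h : c.Represents G B (G.stateSeq (G.classicalTrap B) j))
    (hk : (G.stateSeq (G.classicalTrap B) j).ncard < k) :
    G.cLoop n k c ≠ [] ∧ ∀ (i : ℕ) (hi : i < (G.cLoop n k c).length),
      (G.cLoop n k c)[i].Describes G B (G.stateSeq (G.classicalTrap B) (j + i)) ∧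
      ((G.cLoop n k c)[i].removed = [] ↔ i + 1 = (G.cLoop n k c).length) := by
  induction k generalizing j c with
  | zero => omega
  | succ k ih =>
    have ht := TotalOn.stateSeq (G := G) (G.classicalTrap B) j
    obtain ⟨p1, p2, p3, p4, p5, p6⟩ := h.cTrap_spec ht hn
    obtain ⟨w1, w2, w3, w4⟩ := h.listed.removable_spec ht hn p2 p3 Set.sdiff_subset
    obtain ⟨r1, r2, r3⟩ := h.cRemove_spec w1 fun s hs => G.attr₂_subset _ _ ((w2 s).1 hs)
    have hset : {s | s ∈ (G.removable n c.pred c.deg (G.cTrap n c).val.2).val} =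
        G.attr₂ (G.stateSeq (G.classicalTrap B) j)
          (G.classicalTrap B (G.stateSeq (G.classicalTrap B) j)) := Set.ext w2
    rw [hset] at r1 r3
    have r4 := Finset.card_eq_ncard r3
    rw [w1.length_eq_ncard w2] at r2
    have hd : CIter.Describes G B (G.stateSeq (G.classicalTrap B) j)
        ⟨(G.cTrap n c).val.1, (G.cTrap n c).val.2,
        (G.removable n c.pred c.deg (G.cTrap n c).val.2).val, (G.cTrap n c).cost,
        (G.removable n c.pred c.deg (G.cTrap n c).val.2).cost,
        (cRemove (G.removable n c.pred c.deg (G.cTrap n c).val.2).val c).cost⟩ :=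
      ⟨p1, p3, w2, p4, p5, p6, w3, w4.trans (by rw [← w3]; rfl), r4, r2⟩
    rw [cLoop]
    refine ⟨by simp, ?_⟩
    by_cases hw : (G.removable n c.pred c.deg (G.cTrap n c).val.2).val = []
    · simp only [hw, List.isEmpty_nil, if_true]
      intro i hi
      obtain rfl : i = 0 := by simpa using hi
      simp only [hw] at hd
      exact ⟨hd, by simp⟩
    · have hlt : (G.stateSeq (G.classicalTrap B) (j + 1)).ncard <
          (G.stateSeq (G.classicalTrap B) j).ncard := by
        obtain ⟨s, hs⟩ := List.exists_mem_of_ne_nil _ hw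
        have hs' := (w2 s).1 hs
        refine Set.ncard_lt_ncard ⟨Set.sdiff_subset, fun hsub => ?_⟩
        exact (hsub (G.attr₂_subset _ _ hs')).2 hs'
      obtain ⟨q1, q2⟩ := ih (j + 1) r1 (by omega)
      have hw' : (G.removable n c.pred c.deg (G.cTrap n c).val.2).val.isEmpty = false := by
        simpa using hw
      simp only [hw', Bool.false_eq_true, if_false]
      intro i hi
      cases i with
      | zero =>
        refine ⟨hd, ?_⟩
        simp only [List.getElem_cons_zero, hw, List.length_cons, false_iff]
        intro h0
        exact q1 (List.eq_nil_of_length_eq_zero (by omega))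
      | succ i =>
        have := q2 i (by simpa using hi)
        simp only [List.getElem_cons_succ, List.length_cons]
        rw [show j + (i + 1) = j + 1 + i by omega]
        exact ⟨this.1, this.2.trans (by omega)⟩

end GameGraph

/-! ### Counters and candidate sets of the alternative program. -/

namespace GameGraph

variable {S : Type u} {G : GameGraph S} {B : Finset S} {V : Set S}

/-- A player-2 state with an edge into its own player's attractor is attracted, so a survivor keeps
all its successors. Hence candidates of player 2 need no counter updates. -/
theorem mem_C₂_diff_attr₂ {s : S} {T : Set S} (hs : s ∈ V \ G.attr₂ V T) (hs₁ : s ∉ G.S₁) :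
    s ∈ G.C₂ B (V \ G.attr₂ V T) ↔ s ∈ G.C₂ B V := by
  constructor
  · rintro ⟨-, hB, -, t, ht, he, htB⟩
    exact ⟨hs.1, hB, hs₁, t, ht.1, he, htB⟩
  · rintro ⟨-, hB, -, t, ht, he, htB⟩
    exact ⟨hs, hB, hs₁, t, ⟨ht, fun hA => hs.2 (.own hs.1 hs₁ he hA)⟩, he, htB⟩

variable [DecidableEq S]

/-- The memory of the alternative algorithm represents `G ↾ V`, where the candidates of player 2
are those in `K`. -/
structure AMem.Represents (G : GameGraph S) (B : Finset S) (V K : Set S) (c : AMem S) : Prop where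
  listed : G.IsListed V c.succ c.pred c.deg
  toB_eq : ∀ s ∈ V, c.toB s = (c.succ s).countP (· ∈ B)
  nodup_cand : c.cand.Nodup
  mem_cand : ∀ s, s ∈ c.cand ↔
    s ∈ V ∧ (s ∈ G.S₁ ∧ s ∉ B ∧ c.toB s = 0 ∨ s ∉ G.S₁ ∧ s ∈ K)

theorem AMem.Represents.mem_cand_iff {c : AMem S} (h : c.Represents G B V (G.C₂ B V)) (s : S) :
    s ∈ c.cand ↔ s ∈ G.C₁ B V ∪ G.C₂ B V := by
  rw [h.mem_cand, Set.mem_union]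
  by_cases hV : s ∈ V
  · rw [h.toB_eq s hV, List.countP_eq_zero]
    have hC : s ∈ G.C₁ B V ↔ s ∈ G.S₁ ∧ s ∉ B ∧ ∀ t ∈ c.succ s, ¬ decide (t ∈ B) = true := by
      simp only [decide_eq_true_eq, h.listed.mem_succ s hV]
      exact ⟨fun h => ⟨h.2.2.1, h.2.1, fun t ht => h.2.2.2 t ht.1 ht.2⟩,
        fun h => ⟨hV, h.2.1, h.1, fun t h1 h2 => h.2.2 t ⟨h1, h2⟩⟩⟩
    rw [hC]
    have : s ∈ G.C₂ B V → s ∉ G.S₁ := fun h => h.2.2.1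
    tauto
  · have h1 : s ∉ G.C₁ B V := fun h => hV h.1
    have h2 : s ∉ G.C₂ B V := fun h => hV h.1
    tauto

theorem AdjList.aInit_spec (A : G.AdjList) (B : Finset S) :
    AMem.Represents G B Set.univ (G.C₂ B Set.univ) (A.aInit B).val ∧
    (A.aInit B).edges.card = G.E.card ∧
    (A.aInit B).steps = A.states.length + G.E.card := by
  have hcount : ∀ (s : S) (l : List S) (q : ℕ × ℕ),
      (l.foldlM (fun (q : ULift.{u} (ℕ × ℕ)) t => (do
        Timed.visit (s, t)
        return ULift.up (q.down.1 + 1, if t ∈ B then q.down.2 + 1 else q.down.2) :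
          Timed S (ULift.{u} (ℕ × ℕ)))) (ULift.up q)).val =
      ULift.up (q.1 + l.length, q.2 + l.countP (· ∈ B)) := by
    intro s l
    induction l with
    | nil => simp
    | cons x l ih =>
      intro q
      rw [List.foldlM_cons, Timed.val_bind]
      refine (ih _).trans ?_
      by_cases hx : x ∈ B <;> simp [hx] <;> omega
  have hfold : ∀ (p : S → Prop) [DecidablePred p] (l : List S) (c : AMem S), l.foldl (fun c s =>
      { c with
        deg := Function.update c.deg s (A.succ s).length
        toB := Function.update c.toB s ((A.succ s).countP (· ∈ B))
        cand := if p s then s :: c.cand else c.cand }) c =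
      { c with
        deg := fun s => if s ∈ l then (A.succ s).length else c.deg s
        toB := fun s => if s ∈ l then (A.succ s).countP (· ∈ B) else c.toB s
        cand := (l.filter p).reverse ++ c.cand } := by
    intro p _ l
    induction l with
    | nil => simp
    | cons x l ih =>
      intro c
      rw [List.foldl_cons, ih]
      simp only [AMem.mk.injEq, true_and]
      refine ⟨?_, ?_, ?_⟩
      · funext s
        by_cases hs : s = x
        · subst hs; simp
        · simp [hs]
      · funext s
        by_cases hs : s = x
        · subst hs; simp
        · simp [hs]
      · by_cases hx : p x <;> simp [hx]
  have hval : (A.aInit B).val = ⟨A.succ, A.pred, fun s => (A.succ s).length,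
      fun s => (A.succ s).countP (· ∈ B),
      (A.states.filter fun s => s ∉ B ∧ if s ∈ G.S₁ then (A.succ s).countP (· ∈ B) = 0
        else (A.succ s).countP (· ∈ B) < (A.succ s).length).reverse⟩ := by
    rw [aInit, Timed.val_foldlM]
    simp only [Timed.val_bind, Timed.val_pure, hcount, zero_add]
    rw [hfold (fun s => s ∉ B ∧ if s ∈ G.S₁ then (A.succ s).countP (· ∈ B) = 0
        else (A.succ s).countP (· ∈ B) < (A.succ s).length)]
    simp [A.mem_states]
  refine ⟨?_, A.cost_foldlM ?_ ?_ _⟩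
  · rw [hval]
    constructor
    · exact A.isListed
    · exact fun _ _ => rfl
    · exact List.nodup_reverse.2 (A.nodup_states.filter _)
    · intro s
      -- Fewer edges into `B` than edges in total means that some successor lies outside `B`.
      have hC : s ∉ G.S₁ → (s ∈ G.C₂ B Set.univ ↔
          s ∉ B ∧ (A.succ s).countP (· ∈ B) < (A.succ s).length) := by
        intro hs
        rw [lt_iff_le_and_ne, ne_eq, List.countP_eq_length]
        simp only [C₂, Set.mem_univ, true_and, Set.mem_ofPred_eq, hs, not_false_eq_true,
          List.countP_le_length, decide_eq_true_eq, not_forall, A.mem_succ, exists_prop]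
      simp only [List.mem_reverse, List.mem_filter, A.mem_states, true_and, decide_eq_true_eq,
        Set.mem_univ]
      by_cases hs : s ∈ G.S₁
      · simp [hs]
      · rw [hC hs]; simp [hs]
  · intro c s
    simp only [Timed.steps_bind, Timed.steps_tick, Timed.steps_pure, add_zero]
    rw [Timed.steps_foldlM (by simp)]
  · intro c s
    simp only [Timed.edges_bind, Timed.edges_tick, Timed.edges_pure, Finset.union_empty,
      Finset.empty_union]
    rw [Timed.edges_foldlM (h := fun t => (s, t)) (by simp)]

/-- The memory of the alternative algorithm after the removal of `v`. -/
def AMem.erase (G : GameGraph S) (B : Finset S) (v : S) (c : AMem S) : AMem S where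
  succ u := if u ∈ predErase c.succ c.pred v v then (c.succ u).erase v else c.succ u
  pred := predErase c.succ c.pred v
  deg u := if u ∈ predErase c.succ c.pred v v then c.deg u - 1 else c.deg u
  toB u := if v ∈ B ∧ u ∈ predErase c.succ c.pred v v then c.toB u - 1 else c.toB u
  cand := if v ∈ B then ((predErase c.succ c.pred v v).filter
    fun u => c.toB u = 1 ∧ u ∈ G.S₁ ∧ u ∉ B).reverse ++ c.cand.erase v else c.cand.erase v

/-- `K` stays fixed because, midway through a removal, a player-2 state may already have lost its
last successor outside `B` and yet still be listed. Agreement with `C₂` returns only when the whole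
attractor is gone. -/
theorem AMem.Represents.erase {K : Set S} {c : AMem S} (h : c.Represents G B V K) {v : S}
    (hv : v ∈ V) : (c.erase G B v).Represents G B (V \ {v}) K := by
  have hnp := h.listed.nodup_predErase v hv
  have hmp := h.listed.mem_predErase hv hv
  have hne : (c.cand.erase v).Nodup := h.nodup_cand.erase v
  have hme : ∀ s, s ∈ c.cand.erase v ↔ s ≠ v ∧ s ∈ c.cand := fun s =>
    h.nodup_cand.mem_erase_iff
  constructor
  · exact h.listed.erase hv
  · rintro s ⟨hs, hsv⟩
    simp only [AMem.erase]
    by_cases hsp : s ∈ predErase c.succ c.pred v v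
    · have hvs : v ∈ c.succ s := (h.listed.mem_succ s hs v).2 ⟨hv, ((hmp s).1 hsp).2.2⟩
      simp only [hsp, and_true, if_true, List.countP_erase, hvs, h.toB_eq s hs, true_and,
        decide_eq_true_eq]
      split_ifs <;> rfl
    · simp only [hsp, and_false, if_false, h.toB_eq s hs]
  · simp only [AMem.erase]
    split_ifs
    · refine List.Nodup.append (List.nodup_reverse.2 (hnp.filter _)) hne fun s hs hs' => ?_
      simp only [List.mem_reverse, List.mem_filter, decide_eq_true_eq] at hs
      have := (h.mem_cand s).1 ((hme s).1 hs').2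
      have h1 := hs.2.1
      have h2 := hs.2.2.1
      rcases this.2 with h3 | h3
      · omega
      · exact h3.1 h2
    · exact hne
  · intro s
    simp only [AMem.erase]
    by_cases hvB : v ∈ B
    · simp only [hvB, if_true, true_and, List.mem_append, List.mem_reverse, List.mem_filter,
        decide_eq_true_eq, hme, h.mem_cand, hmp, Set.mem_sdiff, Set.mem_singleton_iff]
      split_ifs with hp <;> rw [hmp] at hp
      -- After truncated subtraction the counter vanishes in two cases: at 0 the state was listed
      -- before, at 1 it is added now.
      · have : c.toB s - 1 = 0 ↔ c.toB s = 0 ∨ c.toB s = 1 := by omega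
        rw [this]
        tauto
      · tauto
    · simp only [hvB, if_false, false_and, hme, h.mem_cand, Set.mem_sdiff, Set.mem_singleton_iff]
      tauto

theorem aRemove_cons (v : S) (w : List S) {K : Set S} {c : AMem S} (h : c.Represents G B V K)
    (hv : v ∈ V) :
    (G.aRemove B (v :: w) c).val = (G.aRemove B w (c.erase G B v)).val ∧
    (G.aRemove B (v :: w) c).steps =
      1 + (eraseEdges c.succ c.pred v).card + (G.aRemove B w (c.erase G B v)).steps ∧
    (G.aRemove B (v :: w) c).edges =
      eraseEdges c.succ c.pred v ∪ (G.aRemove B w (c.erase G B v)).edges := by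
  have hfold₁ : ∀ (l : List S), l.Nodup → ∀ c : AMem S, l.foldl (fun c t =>
      { c with pred := Function.update c.pred t ((c.pred t).erase v) }) c =
      { c with pred := fun x => if x ∈ l then (c.pred x).erase v else c.pred x } := by
    intro l
    induction l with
    | nil => simp
    | cons x l ih =>
      intro hl c
      obtain ⟨hx, hl⟩ := List.nodup_cons.1 hl
      rw [List.foldl_cons, ih hl]
      simp only [AMem.mk.injEq, true_and, and_true]
      funext s
      by_cases hs : s = x
      · subst hs; simp [hx]
      · simp [hs]
  have hfold₂ : ∀ (l : List S), l.Nodup → ∀ c : AMem S, l.foldl (fun c u =>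
      if v ∈ B then
        { c with
          succ := Function.update c.succ u ((c.succ u).erase v)
          deg := Function.update c.deg u (c.deg u - 1)
          toB := Function.update c.toB u (c.toB u - 1)
          cand := if c.toB u = 1 ∧ u ∈ G.S₁ ∧ u ∉ B then u :: c.cand else c.cand }
      else
        { c with
          succ := Function.update c.succ u ((c.succ u).erase v)
          deg := Function.update c.deg u (c.deg u - 1) }) c =
      { c with
        succ := fun u => if u ∈ l then (c.succ u).erase v else c.succ u
        deg := fun u => if u ∈ l then c.deg u - 1 else c.deg u
        toB := fun u => if v ∈ B ∧ u ∈ l then c.toB u - 1 else c.toB u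
        cand := if v ∈ B then (l.filter
          fun u => c.toB u = 1 ∧ u ∈ G.S₁ ∧ u ∉ B).reverse ++ c.cand else c.cand } := by
    intro l
    induction l with
    | nil => simp
    | cons x l ih =>
      intro hl c
      obtain ⟨hx, hl⟩ := List.nodup_cons.1 hl
      rw [List.foldl_cons, ih hl]
      by_cases hv : v ∈ B
      -- Since `x` does not recur in `l`, lowering its counter does not affect the tests for the
      -- remaining states.
      · have hfil : l.filter (fun u => Function.update c.toB x (c.toB x - 1) u = 1 ∧ u ∈ G.S₁ ∧
            u ∉ B) = l.filter (fun u => c.toB u = 1 ∧ u ∈ G.S₁ ∧ u ∉ B) := by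
          refine List.filter_congr fun u hu => ?_
          rw [Function.update_of_ne]
          exact fun h => hx (h ▸ hu)
        simp only [hv, if_true, true_and, AMem.mk.injEq, hfil]
        refine ⟨?_, ?_, ?_, ?_⟩
        · funext s
          by_cases hs : s = x
          · subst hs; simp [hx]
          · simp [hs]
        · funext s
          by_cases hs : s = x
          · subst hs; simp [hx]
          · simp [hs]
        · funext s
          by_cases hs : s = x
          · subst hs; simp [hx]
          · simp [hs]
        · by_cases hq : c.toB x = 1 ∧ x ∈ G.S₁ ∧ x ∉ B
          · simp [hq]
          · simp only [hq, if_false, List.filter_cons, decide_false, Bool.false_eq_true]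
      · simp only [hv, if_false, true_and, and_true, false_and, AMem.mk.injEq]
        constructor <;>
        · funext s
          by_cases hs : s = x
          · subst hs; simp [hx]
          · simp [hs]
  rw [h.listed.card_eraseEdges hv]
  unfold aRemove
  rw [List.foldlM_cons]
  simp only [Timed.val_bind, Timed.steps_bind, Timed.edges_bind, Timed.val_foldlM,
    Timed.val_pure, apply_ite Timed.val]
  rw [hfold₁ _ (h.listed.nodup_succ v hv), hfold₂ _ (by exact h.listed.nodup_predErase v hv)]
  refine ⟨rfl, ?_, ?_⟩
  · rw [Timed.steps_foldlM (by simp), Timed.steps_foldlM]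
    · simp only [Timed.steps_tick, predErase]
      congr 1
    · intro a x
      simp only [Timed.steps_bind, Timed.steps_visit]
      split_ifs <;> rfl
  · rw [Timed.edges_foldlM (h := fun t => (v, t)) (by simp),
      Timed.edges_foldlM (h := fun u => (u, v)), Timed.edges_tick, Finset.empty_union]
    · rfl
    · intro a x
      simp only [Timed.edges_bind, Timed.edges_visit]
      split_ifs <;> simp

theorem AMem.Represents.aRemove_spec {w : List S} (hw : w.Nodup) {K : Set S} {c : AMem S}
    (h : c.Represents G B V K) (hwV : ∀ s ∈ w, s ∈ V) :
    (G.aRemove B w c).val.Represents G B (V \ {s | s ∈ w}) K ∧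
    (G.aRemove B w c).steps = w.length + (G.aRemove B w c).edges.card ∧
    ∀ e, e ∈ (G.aRemove B w c).edges ↔
      e ∈ G.edgesInto V {s | s ∈ w} ∪ G.edgesFrom V {s | s ∈ w} := by
  induction w generalizing c V with
  | nil => simpa [aRemove, edgesInto, edgesFrom] using h
  | cons v w ih =>
    obtain ⟨hv, hw⟩ := List.nodup_cons.1 hw
    have hvV : v ∈ V := hwV v (by simp)
    obtain ⟨i1, i2, i3⟩ := ih hw (h.erase hvV)
      fun s hs => ⟨hwV s (by simp [hs]), fun hsv => hv (hsv ▸ hs)⟩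
    obtain ⟨hval, hsteps, hedges⟩ := aRemove_cons v w h hvV
    have hmem := h.listed.mem_eraseEdges hvV
    refine ⟨?_, ?_, ?_⟩
    · rw [hval]
      convert i1 using 1
      ext s
      simp only [Set.mem_sdiff, Set.mem_ofPred_eq, List.mem_cons, Set.mem_singleton_iff]
      tauto
    · rw [hsteps, hedges, Finset.card_union_of_disjoint, i2, List.length_cons]
      · omega
      · rw [Finset.disjoint_left]
        intro e he he'
        rw [hmem] at he
        rw [i3] at he'
        simp only [edgesInto, edgesFrom, Set.mem_union, Set.mem_ofPred_eq, Set.mem_sdiff,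
          Set.mem_singleton_iff] at he'
        tauto
    · intro e
      rw [hedges, Finset.mem_union, hmem, i3]
      simp only [edgesInto, edgesFrom, Set.mem_union, Set.mem_ofPred_eq, Set.mem_sdiff,
        Set.mem_singleton_iff, List.mem_cons]
      by_cases h1 : e.1 = v <;> by_cases h2 : e.2 = v <;> simp only [h1, h2] <;> tauto

end GameGraph

/-! ### The trap computation of the alternative program. -/

namespace GameGraph

variable {S : Type u} {G : GameGraph S} {B : Finset S} {V : Set S} [DecidableEq S]

/-- The step of the scan of `X` that computes `D` and the out-degrees in `G ↾ X`. -/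
def scanStep (G : GameGraph S) (B : Finset S) (c : AMem S) (mark : S → Bool)
    (p : (S → ℕ) × List S) (s : S) : Timed S ((S → ℕ) × List S) := do
  Timed.tick
  if s ∈ B then
    return (p.1, s :: p.2)
  else
    let q ← (c.succ s).foldlM (fun q t => do
      Timed.visit (s, t)
      return ULift.up
        (if mark t then q.down.1 + 1 else q.down.1,
          if mark t && t ∉ B then q.down.2 + 1 else q.down.2))
      (ULift.up ((0, 0) : ℕ × ℕ))
    let escapes : Prop := if s ∈ G.S₁ then q.down.2 < c.deg s else q.down.2 = 0
    return (Function.update p.1 s q.down.1, if escapes then s :: p.2 else p.2)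

theorem aTrap_eq (n : ℕ) (c : AMem S) : G.aTrap B n c = (do
    let σX ← Search.run n c.pred c.deg (fun s => s ∉ G.S₁) (fun _ => true) c.cand
    let Z ← Timed.select (fun s => s ∉ B) σX.found
    let p ← σX.found.foldlM (scanStep G B c σX.mark) ((fun _ => 0), [])
    let σL ← Search.run n c.pred p.1 (fun s => s ∈ G.S₁) σX.mark p.2
    let tr ← Timed.select (fun s => !σL.mark s) Z
    return ⟨σX.found, Z, p.2, σL.found, tr⟩) := rfl

/-- The states that the scan puts into `D`. -/
def Scanned (G : GameGraph S) (B : Finset S) (c : AMem S) (mark : S → Bool) (s : S) : Prop :=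
  s ∈ B ∨ if s ∈ G.S₁ then (c.succ s).countP (fun t => mark t && t ∉ B) < c.deg s
    else (c.succ s).countP (fun t => mark t && t ∉ B) = 0

instance (c : AMem S) (mark : S → Bool) : DecidablePred (Scanned G B c mark) := fun s =>
  inferInstanceAs (Decidable (s ∈ B ∨ if s ∈ G.S₁ then
    (c.succ s).countP (fun t => mark t && t ∉ B) < c.deg s
    else (c.succ s).countP (fun t => mark t && t ∉ B) = 0))

theorem val_scanStep (c : AMem S) (mark : S → Bool) (p : (S → ℕ) × List S) (s : S) :
    (scanStep G B c mark p s).val =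
      (if s ∈ B then p.1 else Function.update p.1 s ((c.succ s).countP (mark ·)),
        if Scanned G B c mark s then s :: p.2 else p.2) := by
  have hcount : ∀ (l : List S) (q : ℕ × ℕ),
      (l.foldlM (fun (q : ULift.{u} (ℕ × ℕ)) t => (do
        Timed.visit (s, t)
        return ULift.up
          (if mark t then q.down.1 + 1 else q.down.1,
            if mark t && t ∉ B then q.down.2 + 1 else q.down.2) :
          Timed S (ULift.{u} (ℕ × ℕ)))) (ULift.up q)).val =
      ULift.up (q.1 + l.countP (mark ·), q.2 + l.countP fun t => mark t && t ∉ B) := by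
    intro l
    induction l with
    | nil => simp
    | cons x l ih =>
      intro q
      rw [List.foldlM_cons, Timed.val_bind]
      refine (ih _).trans ?_
      rcases Bool.eq_false_or_eq_true (mark x) with hm | hm <;> by_cases hx : x ∈ B <;>
        simp [hx, hm] <;> omega
  unfold scanStep Scanned
  by_cases hB : s ∈ B
  · simp [hB]
  · simp only [hB, if_false, Timed.val_bind, hcount, Timed.val_pure, zero_add, false_or]

theorem steps_scanStep (c : AMem S) (mark : S → Bool) (p : (S → ℕ) × List S) (s : S) :
    (scanStep G B c mark p s).steps = 1 + if s ∈ B then 0 else (c.succ s).length := by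
  unfold scanStep
  by_cases hB : s ∈ B
  · simp [hB]
  · simp only [hB, if_false, Timed.steps_bind, Timed.steps_tick, Timed.steps_pure, add_zero]
    rw [Timed.steps_foldlM (by simp)]

theorem edges_scanStep (c : AMem S) (mark : S → Bool) (p : (S → ℕ) × List S) (s : S) :
    (scanStep G B c mark p s).edges =
      if s ∈ B then ∅ else ((c.succ s).map fun t => (s, t)).toFinset := by
  unfold scanStep
  by_cases hB : s ∈ B
  · simp [hB]
  · simp only [hB, if_false, Timed.edges_bind, Timed.edges_tick, Timed.edges_pure,
      Finset.empty_union, Finset.union_empty]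
    rw [Timed.edges_foldlM (h := fun t => (s, t)) (by simp)]

/-- Different states contribute edges with different sources, so the scan pays one step per state
and one per edge. Büchi states are put into the target without touching an edge. -/
theorem scan_spec {c : AMem S} {mark : S → Bool} {l : List S} (hl : l.Nodup)
    (hs : ∀ s ∈ l, (c.succ s).Nodup) (p : (S → ℕ) × List S) :
    (l.foldlM (scanStep G B c mark) p).val =
      (fun s => if s ∈ l ∧ s ∉ B then (c.succ s).countP (mark ·) else p.1 s,
        (l.filter (Scanned G B c mark ·)).reverse ++ p.2) ∧
    (l.foldlM (scanStep G B c mark) p).steps =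
      l.length + (l.foldlM (scanStep G B c mark) p).edges.card ∧
    ∀ e, e ∈ (l.foldlM (scanStep G B c mark) p).edges ↔
      e.1 ∈ l ∧ e.1 ∉ B ∧ e.2 ∈ c.succ e.1 := by
  induction l generalizing p with
  | nil => simp
  | cons x l ih =>
    obtain ⟨hx, hl⟩ := List.nodup_cons.1 hl
    obtain ⟨h1, h2, h3⟩ := ih hl (fun s h => hs s (by simp [h])) (scanStep G B c mark p x).val
    simp only [List.foldlM_cons, Timed.val_bind, Timed.steps_bind, Timed.edges_bind]
    have hm : ∀ e, e ∈ (scanStep G B c mark p x).edges ↔ e.1 = x ∧ e.1 ∉ B ∧ e.2 ∈ c.succ e.1 := by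
      rintro ⟨a, b⟩
      rw [edges_scanStep]
      split_ifs with hB
      · simp only [Finset.notMem_empty, false_iff]
        rintro ⟨rfl, h, -⟩
        exact h hB
      · simp only [List.mem_toFinset, List.mem_map, Prod.mk.injEq]
        constructor
        · rintro ⟨t, ht, rfl, rfl⟩; exact ⟨rfl, hB, ht⟩
        · rintro ⟨rfl, -, ht⟩; exact ⟨b, ht, rfl, rfl⟩
    refine ⟨?_, ?_, ?_⟩
    · rw [h1, val_scanStep]
      congr 1
      · funext s
        by_cases hsx : s = x
        · subst hsx
          by_cases hB : s ∈ B <;> simp [hx, hB]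
        · by_cases hB : x ∈ B <;> simp [hsx, hB]
      · by_cases hsc : Scanned G B c mark x <;> simp [hsc]
    · rw [Finset.card_union_of_disjoint, h2, steps_scanStep, edges_scanStep, List.length_cons]
      · split_ifs
        · simp; omega
        · rw [List.toFinset_card_of_nodup, List.length_map]
          · omega
          · exact (hs x (by simp)).map fun a b hab => (Prod.mk.inj hab).2
      · rw [Finset.disjoint_left]
        intro e he he'
        exact hx (((hm e).1 he).1 ▸ ((h3 e).1 he').1)
    · intro e
      rw [Finset.mem_union, hm, h3, List.mem_cons]
      tauto

/-- The second search stays inside `X`, so its edges were already inspected by the first one and add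
no work. The work is that of the search for `X` and of the scan of `Z`, with common edges counted
once. -/
theorem AMem.Represents.aTrap_spec [Fintype S] {c : AMem S} (h : c.Represents G B V (G.C₂ B V))
    (ht : G.TotalOn V) {n : ℕ} (hn : Fintype.card S ≤ n) :
    let r := G.aTrap B n c
    (∀ s, s ∈ r.val.X ↔ s ∈ G.X B V) ∧ (∀ s, s ∈ r.val.Z ↔ s ∈ G.Z B V) ∧
    (∀ s, s ∈ r.val.D ↔ s ∈ G.D B V) ∧ (∀ s, s ∈ r.val.L ↔ s ∈ G.L B V) ∧
    r.val.trap.Nodup ∧ (∀ s, s ∈ r.val.trap ↔ s ∈ G.altTrap B V) ∧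
    r.edges.card = (G.edgesInto V (G.X B V) ∪ G.edgesFrom V (G.Z B V)).ncard ∧
    r.edges.card ≤ r.steps ∧ r.steps ≤ 2 + 7 * (G.X B V).ncard + 3 * r.edges.card := by
  obtain ⟨x1, x2, x3, x4, x5⟩ := Search.run_spec (O := (G.S₁ : Set S)ᶜ) (T := G.C₁ B V ∪ G.C₂ B V)
    (own := fun s => s ∉ G.S₁) (h.listed.spec ht (by simp)) hn h.nodup_cand
    (fun s => (h.mem_cand_iff s).trans
      ⟨fun hs => ⟨G.X_subset B V (G.cand_subset_X B V hs), hs⟩, fun hs => hs.2⟩)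
  rw [aTrap_eq]
  simp only [Timed.val_bind, Timed.edges_bind, Timed.steps_bind, Timed.val_pure,
    Timed.edges_pure, Timed.steps_pure, Finset.union_empty, add_zero, Timed.edges_select,
    Timed.steps_select, Timed.val_select, Finset.empty_union]
  generalize Search.run n c.pred c.deg (fun s => decide (s ∉ G.S₁)) (fun _ => true) c.cand = rX at *
  change ∀ s, s ∈ rX.val.found ↔ s ∈ G.X B V at x2
  have hXV : ∀ s ∈ rX.val.found, s ∈ V := fun s hs => G.X_subset B V ((x2 s).1 hs)
  obtain ⟨d1, d2, d3⟩ := scan_spec (G := G) (B := B) (c := c) (mark := rX.val.mark) x1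
    (fun s hs => h.listed.nodup_succ s (hXV s hs)) ((fun _ => 0), [])
  generalize rX.val.found.foldlM (scanStep G B c rX.val.mark) ((fun _ => 0), []) = rD at *
  have hmarkX : ∀ s, rX.val.mark s = true ↔ s ∈ G.X B V := fun s => (x3 s).trans (x2 s)
  have hZ : ∀ s, s ∈ (rX.val.found.filter fun s => decide (s ∉ B)).reverse ↔ s ∈ G.Z B V := by
    intro s
    simp only [List.mem_reverse, List.mem_filter, x2, decide_eq_true_eq]
    exact ⟨fun hs => ⟨hs.1, G.X_subset B V hs.1, hs.2⟩, fun hs => ⟨hs.1, hs.2.2⟩⟩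
  have hmarkZ : ∀ t, (rX.val.mark t && decide (t ∉ B)) = true ↔ t ∈ G.Z B V := by
    intro t
    rw [← hZ]
    simp [x3]
  have hD : ∀ s, s ∈ rD.val.2 ↔ s ∈ G.D B V := by
    intro s
    rw [d1]
    simp only [List.append_nil, List.mem_reverse, List.mem_filter, decide_eq_true_eq]
    by_cases hX : s ∈ G.X B V
    · have hV := G.X_subset B V hX
      have hXf := (x2 s).2 hX
      by_cases hB : s ∈ B
      · have hnZ : s ∉ G.Z B V := fun hs => hs.2.2 hB
        exact iff_of_true ⟨hXf, Or.inl hB⟩ (Or.inr ⟨hX, hnZ⟩)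
      · have hsZ : s ∈ G.Z B V := ⟨hX, hV, hB⟩
        simp only [hXf, true_and, Scanned, hB, false_or]
        by_cases hs₁ : s ∈ G.S₁
        · have hD' : s ∈ G.D B V ↔ ∃ t ∈ V, (s, t) ∈ G.E ∧ t ∉ G.Z B V := by
            constructor
            · rintro ((h | h) | h)
              exacts [h.2.2, absurd hs₁ h.1, absurd hsZ h.2]
            · exact fun h => Or.inl (Or.inl ⟨hs₁, hsZ, h⟩)
          rw [hD', if_pos hs₁, h.listed.deg_eq s hV, lt_iff_le_and_ne, ne_eq,
            List.countP_eq_length]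
          simp only [List.countP_le_length, hmarkZ, h.listed.mem_succ s hV, true_and, not_forall,
            and_imp, exists_prop]
        · have hD' : s ∈ G.D B V ↔ ∀ t ∈ V, (s, t) ∈ G.E → t ∉ G.Z B V := by
            constructor
            · rintro ((h | h) | h)
              exacts [absurd h.1 hs₁, h.2.2, absurd hsZ h.2]
            · exact fun h => Or.inl (Or.inr ⟨hs₁, hsZ, h⟩)
          rw [hD', if_neg hs₁, List.countP_eq_zero]
          simp only [hmarkZ, h.listed.mem_succ s hV, and_imp]
    · refine iff_of_false (fun hs => hX ((x2 s).1 hs.1)) fun hs => hX (G.D_subset_X B V hs)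
  have hDnd : rD.val.2.Nodup := by
    rw [d1]
    simpa using x1.filter _
  -- The degree array is filled only on `Z`. That suffices, because the search reads degrees only
  -- outside its target and `X \ Z ⊆ D`.
  have hspec : Search.Spec G V (G.X B V) (G.S₁ : Set S) (G.D B V) c.pred rD.val.1
      (fun s => decide (s ∈ G.S₁)) rX.val.mark := by
    have hval : ∀ u ∈ G.X B V, u ∉ G.D B V → u ∈ G.Z B V ∧
        rD.val.1 u = (c.succ u).countP (rX.val.mark ·) := by
      intro u hu huD
      have huZ : u ∈ G.Z B V := by
        by_contra hc
        exact huD (Or.inr ⟨hu, hc⟩)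
      refine ⟨huZ, ?_⟩
      rw [d1]
      exact if_pos ⟨(x2 u).2 hu, huZ.2.2⟩
    constructor
    · exact G.X_subset B V
    · exact fun v hv => h.listed.nodup_pred v (G.X_subset B V hv)
    · exact fun v hv => h.listed.mem_pred v (G.X_subset B V hv)
    · exact fun u _ => hmarkX u
    · simp
    · intro u hu hu₁ huD
      obtain ⟨huZ, hv⟩ := hval u hu huD
      rw [hv, List.countP_pos_iff]
      by_contra! hc
      -- A player-2 state of `Z` outside `D` has a successor in `Z`, hence in `X`, so its degree in
      -- `G ↾ X` is positive.
      refine huD (Or.inl (Or.inr ⟨hu₁, huZ, fun t ht he htZ => ?_⟩))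
      exact hc t ((h.listed.mem_succ u huZ.2.1 t).2 ⟨ht, he⟩) ((hmarkX t).2 htZ.1)
    · intro u hu hu₁ huD
      obtain ⟨huZ, hv⟩ := hval u hu huD
      rw [hv, List.countP_eq_length_filter]
      refine ((h.listed.nodup_succ u huZ.2.1).filter _).length_eq_ncard fun t => ?_
      rw [List.mem_filter, h.listed.mem_succ u huZ.2.1, hmarkX]
      exact ⟨fun ht => ⟨ht.2, ht.1.2⟩, fun ht => ⟨⟨G.X_subset B V ht.1, ht.2⟩, ht.1⟩⟩
  obtain ⟨l1, l2, l3, l4, l5⟩ := Search.run_spec hspec hn hDnd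
    (fun s => (hD s).trans ⟨fun hs => ⟨G.D_subset_X B V hs, hs⟩, fun hs => hs.2⟩)
  generalize Search.run n c.pred rD.val.1 (fun s => decide (s ∈ G.S₁)) rX.val.mark rD.val.2 = rL
    at *
  change ∀ s, s ∈ rL.val.found ↔ s ∈ G.L B V at l2
  have hLX : G.L B V ⊆ G.X B V := G.attr₁_subset _ _
  have e1 : ∀ e, e ∈ rX.edges ↔ e ∈ G.edgesInto V (G.X B V) := by
    intro e
    rw [x5, x2]
    exact ⟨fun he => ⟨he.1, he.2.1, G.X_subset B V he.1, he.2.2⟩,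
      fun he => ⟨he.1, he.2.1, he.2.2.2⟩⟩
  have e2 : ∀ e, e ∈ rD.edges ↔ e ∈ G.edgesFrom V (G.Z B V) := by
    intro e
    rw [d3, x2]
    constructor
    · rintro ⟨h1, h2, h3⟩
      have hV := G.X_subset B V h1
      rw [h.listed.mem_succ _ hV] at h3
      exact ⟨⟨h1, hV, h2⟩, hV, h3⟩
    · rintro ⟨h1, h2, h3⟩
      exact ⟨h1.1, h1.2.2, (h.listed.mem_succ _ h2 _).2 h3⟩
  have e3 : ∀ e, e ∈ rL.edges → e ∈ rX.edges := by
    intro e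
    rw [l5, x5, x2, l2]
    exact fun he => ⟨hLX he.1, he.2⟩
  have hE : rX.edges ∪ (rD.edges ∪ rL.edges) = rX.edges ∪ rD.edges := by
    ext e
    have := e3 e
    simp only [Finset.mem_union]
    tauto
  have hcX := x1.length_eq_ncard x2
  have hcZ : (rX.val.found.filter fun s => decide (s ∉ B)).reverse.length ≤ (G.X B V).ncard := by
    rw [List.length_reverse, ← hcX]
    exact List.length_filter_le _ _
  have hcand : c.cand.length ≤ (G.X B V).ncard := by
    rw [h.nodup_cand.length_eq_ncard h.mem_cand_iff]
    exact Set.ncard_le_ncard (G.cand_subset_X B V)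
  have hcD : rD.val.2.length ≤ (G.X B V).ncard := by
    rw [hDnd.length_eq_ncard hD]
    exact Set.ncard_le_ncard (G.D_subset_X B V)
  have hcL : rL.val.found.length ≤ (G.X B V).ncard := by
    rw [l1.length_eq_ncard l2]
    exact Set.ncard_le_ncard hLX
  have hu1 : rX.edges.card ≤ (rX.edges ∪ rD.edges).card :=
    Finset.card_le_card Finset.subset_union_left
  have hu2 : rD.edges.card ≤ (rX.edges ∪ rD.edges).card :=
    Finset.card_le_card Finset.subset_union_right
  have hu3 : rL.edges.card ≤ (rX.edges ∪ rD.edges).card :=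
    Finset.card_le_card fun e he => Finset.mem_union_left _ (e3 e he)
  have hu4 := Finset.card_union_le rX.edges rD.edges
  refine ⟨x2, hZ, hD, l2, ?_, ?_, ?_, ?_, ?_⟩
  · exact List.nodup_reverse.2 ((List.nodup_reverse.2 (x1.filter _)).filter _)
  · intro s
    rw [List.mem_reverse, List.mem_filter, hZ, Bool.not_eq_true', ← Bool.not_eq_true, l3, l2]
    rfl
  · rw [hE]
    refine Finset.card_eq_ncard fun e => ?_
    rw [Finset.mem_union, e1, e2]
    rfl
  · rw [hE, x4, d2]
    omega
  -- The factor 7 counts lists of at most `|X|` states: the candidates, the found set of the first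
  -- search, its filtering to `Z`, the scan, `D`, `L`, and the final filtering of `Z`. The factor 3
  -- counts the two searches and the scan.
  · rw [hE, x4, d2, l4]
    omega

/-- What the record of an iteration of the alternative algorithm on `G ↾ V` says. -/
structure AIter.Describes (G : GameGraph S) (B : Finset S) (V : Set S) (a : AIter S) : Prop where
  cand : ∀ s, s ∈ a.cand ↔ s ∈ G.C₁ B V ∪ G.C₂ B V
  X : ∀ s, s ∈ a.sets.X ↔ s ∈ G.X B V
  Z : ∀ s, s ∈ a.sets.Z ↔ s ∈ G.Z B V
  D : ∀ s, s ∈ a.sets.D ↔ s ∈ G.D B V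
  L : ∀ s, s ∈ a.sets.L ↔ s ∈ G.L B V
  trap : ∀ s, s ∈ a.sets.trap ↔ s ∈ G.altTrap B V
  removed : ∀ s, s ∈ a.removed ↔ s ∈ G.attr₂ V (G.altTrap B V)
  trap_work : a.trapCost.work = (G.edgesInto V (G.X B V) ∪ G.edgesFrom V (G.Z B V)).ncard
  le_trap_steps : a.trapCost.work ≤ a.trapCost.steps
  trap_steps_le : a.trapCost.steps ≤ 2 + 7 * (G.X B V).ncard + 3 * a.trapCost.work
  costs : RemovalCosts G V (G.altTrap B V) a.attrCost a.removeCost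

theorem aLoop_spec [Fintype S] {n : ℕ} (hn : Fintype.card S ≤ n) (k j : ℕ) {c : AMem S}
    (h : c.Represents G B (G.stateSeq (G.altTrap B) j)
      (G.C₂ B (G.stateSeq (G.altTrap B) j)))
    (hk : (G.stateSeq (G.altTrap B) j).ncard < k) :
    G.aLoop B n k c ≠ [] ∧ ∀ (i : ℕ) (hi : i < (G.aLoop B n k c).length),
      (G.aLoop B n k c)[i].Describes G B (G.stateSeq (G.altTrap B) (j + i)) ∧
      ((G.aLoop B n k c)[i].removed = [] ↔ i + 1 = (G.aLoop B n k c).length) := by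
  induction k generalizing j c with
  | zero => omega
  | succ k ih =>
    have ht := TotalOn.stateSeq (G := G) (G.altTrap B) j
    obtain ⟨p1, p2, p3, p4, p5, p6, p7, p8, p9⟩ := h.aTrap_spec ht hn
    obtain ⟨w1, w2, w3, w4⟩ := h.listed.removable_spec ht hn p5 p6
      (Set.sdiff_subset.trans fun _ hs => hs.2.1)
    obtain ⟨r1, r2, r3⟩ := h.aRemove_spec w1 fun s hs => G.attr₂_subset _ _ ((w2 s).1 hs)
    have hset : {s | s ∈ (G.removable n c.pred c.deg (G.aTrap B n c).val.trap).val} =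
        G.attr₂ (G.stateSeq (G.altTrap B) j)
          (G.altTrap B (G.stateSeq (G.altTrap B) j)) := Set.ext w2
    rw [hset] at r1 r3
    have r4 := Finset.card_eq_ncard r3
    rw [w1.length_eq_ncard w2] at r2
    have hd : AIter.Describes G B (G.stateSeq (G.altTrap B) j)
        ⟨c.cand, (G.aTrap B n c).val,
        (G.removable n c.pred c.deg (G.aTrap B n c).val.trap).val, (G.aTrap B n c).cost,
        (G.removable n c.pred c.deg (G.aTrap B n c).val.trap).cost,
        (G.aRemove B (G.removable n c.pred c.deg (G.aTrap B n c).val.trap).val c).cost⟩ :=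
      ⟨h.mem_cand_iff, p1, p2, p3, p4, p6, w2, p7, p8, p9, w3, w4.trans (by rw [← w3]; rfl),
        r4, r2⟩
    rw [aLoop]
    refine ⟨by simp, ?_⟩
    by_cases hw : (G.removable n c.pred c.deg (G.aTrap B n c).val.trap).val = []
    · simp only [hw, List.isEmpty_nil, if_true]
      intro i hi
      obtain rfl : i = 0 := by simpa using hi
      simp only [hw] at hd
      exact ⟨hd, by simp⟩
    · have hlt : (G.stateSeq (G.altTrap B) (j + 1)).ncard <
          (G.stateSeq (G.altTrap B) j).ncard := by
        obtain ⟨s, hs⟩ := List.exists_mem_of_ne_nil _ hw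
        have hs' := (w2 s).1 hs
        refine Set.ncard_lt_ncard ⟨Set.sdiff_subset, fun hsub => ?_⟩
        exact (hsub (G.attr₂_subset _ _ hs')).2 hs'
      -- With the attractor removed completely, the frozen old `C₂` may be replaced by the new one.
      have r1' : (G.aRemove B (G.removable n c.pred c.deg
          (G.aTrap B n c).val.trap).val c).val.Represents G B (G.stateSeq (G.altTrap B) (j + 1))
          (G.C₂ B (G.stateSeq (G.altTrap B) (j + 1))) := by
        refine ⟨r1.listed, r1.toB_eq, r1.nodup_cand, fun s => ?_⟩
        rw [r1.mem_cand]
        refine and_congr_right fun hs => or_congr_right (and_congr_right fun hs₁ => ?_)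
        exact (mem_C₂_diff_attr₂ hs hs₁).symm
      obtain ⟨q1, q2⟩ := ih (j + 1) r1' (by omega)
      have hw' : (G.removable n c.pred c.deg (G.aTrap B n c).val.trap).val.isEmpty = false := by
        simpa using hw
      simp only [hw', Bool.false_eq_true, if_false]
      intro i hi
      cases i with
      | zero =>
        refine ⟨hd, ?_⟩
        simp only [List.getElem_cons_zero, hw, List.length_cons, false_iff]
        intro h0
        exact q1 (List.eq_nil_of_length_eq_zero (by omega))
      | succ i =>
        have := q2 i (by simpa using hi)
        simp only [List.getElem_cons_succ, List.length_cons]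
        rw [show j + (i + 1) = j + 1 + i by omega]
        exact ⟨this.1, this.2.trans (by omega)⟩

end GameGraph

/-! ### Summing bounds over the iterations. -/

/-- Only the last entry may use the additive term; this keeps the number of iterations out of the
final bound. -/
theorem List.sum_map_le_mul_add {α : Type*} (f g : α → ℕ) (K d : ℕ) (l : List α)
    (h : ∀ (i : ℕ) (hi : i < l.length), f l[i] ≤ K * g l[i] + if i + 1 = l.length then d else 0) :
    (l.map f).sum ≤ K * (l.map g).sum + d := by
  induction l with
  | nil => simp
  | cons x l ih =>
    have h0 := h 0 (by simp)
    have hl := ih fun i hi => by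
      simpa only [List.getElem_cons_succ, List.length_cons, Nat.add_right_cancel_iff] using
        h (i + 1) (Nat.succ_lt_succ hi)
    simp only [List.map_cons, List.sum_cons, mul_add]
    simp only [List.getElem_cons_zero, List.length_cons, Nat.add_right_cancel_iff] at h0
    by_cases hl0 : l = []
    · subst hl0
      simpa using h0
    · rw [if_neg (fun h' => hl0 (List.eq_nil_of_length_eq_zero h'.symm))] at h0
      omega

theorem List.sum_map_le_sum_map_add {α β : Type*} (f : α → ℕ) (g : β → ℕ) (t : ℕ → ℕ)
    (l : List α) (l' : List β) (hl : l.length = l'.length)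
    (h : ∀ (i : ℕ) (hi : i < l.length) (hi' : i < l'.length), f l[i] ≤ g l'[i] + t i) :
    (l.map f).sum ≤ (l'.map g).sum + ∑ i ∈ Finset.range l.length, t i := by
  induction l generalizing l' t with
  | nil => simp
  | cons x l ih =>
    cases l' with
    | nil => simp at hl
    | cons y l' =>
      have h0 := h 0 (by simp) (by simp)
      have h1 := ih (fun i => t (i + 1)) l' (by simpa using hl) fun i hi hi' => by
        simpa only [List.getElem_cons_succ] using
          h (i + 1) (Nat.succ_lt_succ hi) (Nat.succ_lt_succ hi')
      simp only [List.map_cons, List.sum_cons, List.length_cons, Finset.sum_range_succ']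
      simp only [List.getElem_cons_zero] at h0
      omega

/-! ### Charging states to edges within one iteration. -/

namespace GameGraph

variable {S : Type u} {G : GameGraph S} {B : Finset S} {V : Set S} [Fintype S]

/-- The trap lies in the removed set, whose states are charged to edges entering it. This work pays
for the state overhead of both the search and the deletion. -/
theorem RemovalCosts.bounds {attr remove : Cost}
    (h : RemovalCosts G V (G.classicalTrap B V) attr remove) (ht : G.TotalOn V) :
    (G.attr₂ V (G.classicalTrap B V)).ncard ≤ attr.work ∧
    attr.work + 1 ≤ attr.steps ∧ attr.steps ≤ 1 + 3 * attr.work ∧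
    remove.work ≤ remove.steps ∧ remove.steps ≤ attr.work + remove.work := by
  have hT : (G.classicalTrap B V).ncard ≤ (G.attr₂ V (G.classicalTrap B V)).ncard :=
    Set.ncard_le_ncard fun s hs => .base hs.1 hs
  have hW : (G.attr₂ V (G.classicalTrap B V)).ncard ≤ attr.work := by
    rw [h.attr_work]
    refine ncard_le_of_forall_exists_edge fun s hs => ?_
    obtain ⟨t, h1, he⟩ := ht.exists_succ_mem_attr₂ (B := B) hs
    exact ⟨t, h1, hs.mem, h1.mem, he⟩
  have h1 := h.attr_steps
  have h2 := h.remove_steps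
  omega

/-- A successor of a state lies in `R` or in the trap, so the classical scan of all of `V` is paid
by phases (a) and (b) together. -/
theorem ncard_le_edgesInto_reachSet_add (ht : G.TotalOn V) :
    V.ncard ≤ (G.edgesInto V (G.reachSet B V)).ncard +
      (G.edgesInto V (G.attr₂ V (G.classicalTrap B V))).ncard := by
  refine le_trans (ncard_le_of_forall_exists_edge fun s hs => ?_) (Set.ncard_union_le _ _)
  obtain ⟨t, htV, he⟩ := ht s hs
  refine ⟨t, ?_⟩
  by_cases hR : t ∈ G.reachSet B V
  · exact Or.inl ⟨hR, hs, htV, he⟩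
  · exact Or.inr ⟨.base htV ⟨htV, hR⟩, hs, htV, he⟩

/-- A Büchi state is not a candidate and entered `X` through an edge into `X`; any other state of
`X` is in `Z`, and its outgoing edges are scanned. -/
theorem ncard_X_le (ht : G.TotalOn V) :
    (G.X B V).ncard ≤ (G.edgesInto V (G.X B V) ∪ G.edgesFrom V (G.Z B V)).ncard := by
  refine ncard_le_of_forall_exists_edge fun s hs => ?_
  have hV := G.X_subset B V hs
  by_cases hB : s ∈ B
  · cases hs with
    | base _ hC => exact absurd hB (hC.elim (fun h => h.2.1) fun h => h.2.1)
    | @own _ t _ _ he htA => exact ⟨t, Or.inl ⟨htA, hV, htA.mem, he⟩⟩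
    | opp _ _ hA =>
      obtain ⟨t, htV, he⟩ := ht s hV
      exact ⟨t, Or.inl ⟨hA t htV he, hV, htV, he⟩⟩
  · obtain ⟨t, htV, he⟩ := ht s hV
    exact ⟨t, Or.inr ⟨⟨hs, hV, hB⟩, hV, htV, he⟩⟩

/-- The bound holds for any set of edges of `G ↾ V`: the target of an edge lies either in `R`, and
the classical search inspects it, or in the trap. -/
theorem ncard_scanned_le (G : GameGraph S) (B : Finset S) (V : Set S) :
    (G.edgesInto V (G.X B V) ∪ G.edgesFrom V (G.Z B V)).ncard ≤
      (G.edgesInto V (G.reachSet B V)).ncard +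
      {e : S × S | e ∈ G.E ∧ e.1 ∈ V ∧ e.2 ∈ G.altTrap B V}.ncard := by
  rw [altTrap_eq_classicalTrap]
  refine (Set.ncard_le_ncard ?_).trans (Set.ncard_union_le _ _)
  have key : ∀ e : S × S, e.1 ∈ V → e.2 ∈ V → e ∈ G.E → e ∈ G.edgesInto V (G.reachSet B V) ∪
      {e : S × S | e ∈ G.E ∧ e.1 ∈ V ∧ e.2 ∈ G.classicalTrap B V} := by
    intro e h1 h2 he
    by_cases hR : e.2 ∈ G.reachSet B V
    · exact Or.inl ⟨hR, h1, h2, he⟩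
    · exact Or.inr ⟨he, h1, h2, hR⟩
  rintro e (h | h)
  exacts [key e h.2.1 h.2.2.1 h.2.2.2, key e h.2.1 h.2.2.1 h.2.2.2]

theorem sum_trapEdges_le (G : GameGraph S) (B : Finset S) (k : ℕ) :
    ∑ i ∈ Finset.range k, (G.trapEdges B i).ncard ≤ G.E.card := by
  rw [← G.sum_ncard_edges_add (G.altTrap B) k]
  refine le_add_right (Finset.sum_le_sum fun i _ => Set.ncard_le_ncard ?_)
  refine (G.edgesInto_trap_subset _ ?_).trans Set.subset_union_left
  exact fun s hs => hs.1.2.1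

theorem CIter.Describes.bounds {a : CIter S} (h : a.Describes G B V) (ht : G.TotalOn V) :
    a.trapCost.work + a.attrCost.work + a.removeCost.work + 1 ≤
      a.trapCost.steps + a.attrCost.steps + a.removeCost.steps ∧
    a.trapCost.steps + a.attrCost.steps + a.removeCost.steps ≤
      9 * (a.trapCost.work + a.attrCost.work + a.removeCost.work) +
        if a.removed = [] then 2 else 0 := by
  obtain ⟨h1, h2, h3, h4, h5⟩ := h.costs.bounds ht
  have h6 := ncard_le_edgesInto_reachSet_add (B := B) ht
  rw [← h.trap_work, ← h.costs.attr_work] at h6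
  have h7 := h.lt_trap_steps
  have h8 := h.trap_steps_le
  split_ifs with hr
  · omega
  · obtain ⟨s, hs⟩ := List.exists_mem_of_ne_nil _ hr
    -- With work `a`, `b`, `c` of the three phases, the steps are at most `2 + 4a + 7b + c`. A
    -- nonempty removal gives `b ≥ 1`, which absorbs the 2 and yields the factor 9.
    have := (Set.ncard_pos (Set.toFinite _)).2 ⟨s, (h.removed s).1 hs⟩
    omega

theorem AIter.Describes.bounds {a : AIter S} (h : a.Describes G B V) (ht : G.TotalOn V) :
    a.trapCost.work + a.attrCost.work + a.removeCost.work ≤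
      a.trapCost.steps + a.attrCost.steps + a.removeCost.steps ∧
    a.trapCost.steps + a.attrCost.steps + a.removeCost.steps ≤
      13 * (a.trapCost.work + a.attrCost.work + a.removeCost.work) +
        if a.removed = [] then 3 else 0 := by
  have hc := h.costs
  have hr' := h.removed
  rw [altTrap_eq_classicalTrap] at hc hr'
  obtain ⟨h1, h2, h3, h4, h5⟩ := hc.bounds ht
  have h6 := ncard_X_le (B := B) ht
  rw [← h.trap_work] at h6
  have h7 := h.le_trap_steps
  have h8 := h.trap_steps_le
  split_ifs with hr
  · omega
  · obtain ⟨s, hs⟩ := List.exists_mem_of_ne_nil _ hr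
    -- Here the steps are at most `3 + 10a + 4b + c`, and again `b ≥ 1` absorbs the constant; the
    -- factor 13 leaves slack.
    have := (Set.ncard_pos (Set.toFinite _)).2 ⟨s, (hr' s).1 hs⟩
    omega

variable [DecidableEq S]

theorem AdjList.length_states {G : GameGraph S} (A : G.AdjList) :
    A.states.length = Fintype.card S := by
  rw [A.nodup_states.length_eq_ncard (W := Set.univ) (by simp [A.mem_states]), Set.ncard_univ,
    Nat.card_eq_fintype_card]

theorem AdjList.classical_spec (A : G.AdjList) (B : Finset S) :
    (A.classical B).iters ≠ [] ∧ ∀ (i : ℕ) (hi : i < (A.classical B).iters.length),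
      (A.classical B).iters[i].Describes G B (G.stateSeq (G.classicalTrap B) i) ∧
      ((A.classical B).iters[i].removed = [] ↔ i + 1 = (A.classical B).iters.length) := by
  have h := cLoop_spec (n := A.states.length) A.length_states.ge
    (A.states.length + 1) 0 (A.cInit_spec B).1
    (by simp [stateSeq, A.length_states, Set.ncard_univ])
  simp only [zero_add] at h
  exact h

theorem AdjList.alternative_spec (A : G.AdjList) (B : Finset S) :
    (A.alternative B).iters ≠ [] ∧ ∀ (i : ℕ) (hi : i < (A.alternative B).iters.length),
      (A.alternative B).iters[i].Describes G B (G.stateSeq (G.altTrap B) i) ∧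
      ((A.alternative B).iters[i].removed = [] ↔ i + 1 = (A.alternative B).iters.length) := by
  have h := aLoop_spec (n := A.states.length) A.length_states.ge
    (A.states.length + 1) 0 (A.aInit_spec B).1
    (by simp [stateSeq, A.length_states, Set.ncard_univ])
  simp only [zero_add] at h
  exact h

theorem AdjList.classical_computes (A : G.AdjList) (B : Finset S) :
    (A.classical B).Computes G B := by
  obtain ⟨h1, h2⟩ := A.classical_spec B
  refine ⟨h1, fun i hi => ?_⟩
  obtain ⟨h3, h4⟩ := h2 i hi
  exact ⟨Set.ext h3.reach, Set.ext h3.trap, Set.ext h3.removed, h4⟩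

theorem AdjList.alternative_computes (A : G.AdjList) (B : Finset S) :
    (A.alternative B).Computes G B := by
  obtain ⟨h1, h2⟩ := A.alternative_spec B
  refine ⟨h1, fun i hi => ?_⟩
  obtain ⟨h3, h4⟩ := h2 i hi
  exact ⟨Set.ext h3.cand, Set.ext h3.X, Set.ext h3.Z, Set.ext h3.D, Set.ext h3.L,
    Set.ext h3.trap, Set.ext h3.removed, h4⟩

/-- Both runs stop at their first empty removal, and their removed sets agree; a shorter run would
force the longer one to have stopped as well. -/
theorem AdjList.length_alternative (A : G.AdjList) (B : Finset S) :
    (A.alternative B).iters.length = (A.classical B).iters.length := by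
  obtain ⟨a1, a2⟩ := A.alternative_spec B
  obtain ⟨c1, c2⟩ := A.classical_spec B
  rw [← funext (G.altTrap_eq_classicalTrap B)] at c2
  have ha := List.length_pos_of_ne_nil a1
  have hc := List.length_pos_of_ne_nil c1
  have hiff : ∀ i (h1 : i < (A.alternative B).iters.length)
      (h2 : i < (A.classical B).iters.length), (A.alternative B).iters[i].removed = [] ↔
      (A.classical B).iters[i].removed = [] := by
    intro i h1 h2
    simp only [List.eq_nil_iff_forall_not_mem, (a2 i h1).1.removed, (c2 i h2).1.removed,
      altTrap_eq_classicalTrap]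
  rcases lt_trichotomy (A.alternative B).iters.length (A.classical B).iters.length with h | h | h
  · have h1 := ((a2 _ (Nat.sub_one_lt ha.ne')).2).2 (by omega)
    rw [hiff _ _ (by omega), (c2 _ (by omega)).2] at h1
    omega
  · exact h
  · have h1 := ((c2 _ (Nat.sub_one_lt hc.ne')).2).2 (by omega)
    rw [← hiff _ (by omega), (a2 _ (by omega)).2] at h1
    omega

end GameGraph

/-! ### Bounds for complete runs. -/

namespace GameGraph

variable {S : Type u} {G : GameGraph S} [Fintype S] [DecidableEq S] (A : G.AdjList) (B : Finset S)

theorem AdjList.alternative_trapCost_work_le (i : ℕ) (h₂ : i < (A.alternative B).iters.length)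
    (h₁ : i < (A.classical B).iters.length) :
    (A.alternative B).iters[i].trapCost.work ≤
      (A.classical B).iters[i].trapCost.work + (G.trapEdges B i).ncard := by
  have ha := ((A.alternative_spec B).2 i h₂).1
  have hc := ((A.classical_spec B).2 i h₁).1
  rw [ha.trap_work, hc.trap_work, ← funext (G.altTrap_eq_classicalTrap B)]
  exact ncard_scanned_le G B _

theorem AdjList.alternative_work_le :
    (A.alternative B).work ≤ (A.classical B).work + G.E.card := by
  obtain ⟨-, a2⟩ := A.alternative_spec B
  obtain ⟨-, c2⟩ := A.classical_spec B
  have hsum := List.sum_map_le_sum_map_add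
    (fun a : AIter S => a.trapCost.work + a.attrCost.work + a.removeCost.work)
    (fun a : CIter S => a.trapCost.work + a.attrCost.work + a.removeCost.work)
    (fun i => (G.trapEdges B i).ncard) _ _ (A.length_alternative B) fun i h₂ h₁ => by
      have h := A.alternative_trapCost_work_le B i h₂ h₁
      have ha := (a2 i h₂).1.costs
      have hc := (c2 i h₁).1.costs
      rw [← funext (G.altTrap_eq_classicalTrap B)] at hc
      rw [ha.attr_work, ha.remove_work, hc.attr_work, hc.remove_work]
      omega
  have ht := G.sum_trapEdges_le B (A.alternative B).iters.length
  have hi : (A.alternative B).initCost.work = (A.classical B).initCost.work :=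
    (A.aInit_spec B).2.1.trans (A.cInit_spec B).2.1.symm
  unfold ARun.work CRun.work
  omega

theorem AdjList.classical_steps_bounds :
    (A.classical B).work + 1 ≤ (A.classical B).steps ∧
    (A.classical B).steps ≤ 9 * ((A.classical B).work + 1) := by
  obtain ⟨c1, c2⟩ := A.classical_spec B
  have hb := fun i hi => (c2 i hi).1.bounds (TotalOn.stateSeq _ i)
  have h1 := List.sum_map_le_mul_add
    (fun a : CIter S => a.trapCost.steps + a.attrCost.steps + a.removeCost.steps)
    (fun a : CIter S => a.trapCost.work + a.attrCost.work + a.removeCost.work) 9 2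
    (A.classical B).iters fun i hi => by simpa only [(c2 i hi).2] using (hb i hi).2
  have h2 := List.sum_map_le_mul_add
    (fun a : CIter S => a.trapCost.work + a.attrCost.work + a.removeCost.work + 1)
    (fun a : CIter S => a.trapCost.steps + a.attrCost.steps + a.removeCost.steps) 1 0
    (A.classical B).iters fun i hi => by simpa only [one_mul, ite_self, add_zero] using (hb i hi).1
  -- The extra 1 per iteration sums to the number of iterations, which is positive. This gives work
  -- plus one at most steps.
  rw [List.sum_map_add, List.map_const', List.sum_replicate, smul_eq_mul, mul_one] at h2
  have hlen := List.length_pos_of_ne_nil c1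
  have hw : (A.classical B).initCost.work = G.E.card := (A.cInit_spec B).2.1
  have hs : (A.classical B).initCost.steps = A.states.length + G.E.card := (A.cInit_spec B).2.2
  have hS := G.card_le_card_edges
  rw [← A.length_states] at hS
  unfold CRun.work CRun.steps
  omega

theorem AdjList.alternative_steps_bounds :
    (A.alternative B).work ≤ (A.alternative B).steps ∧
    (A.alternative B).steps ≤ 13 * ((A.alternative B).work + 1) := by
  obtain ⟨-, a2⟩ := A.alternative_spec B
  have hb := fun i hi => (a2 i hi).1.bounds (TotalOn.stateSeq _ i)
  have h1 := List.sum_map_le_mul_add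
    (fun a : AIter S => a.trapCost.steps + a.attrCost.steps + a.removeCost.steps)
    (fun a : AIter S => a.trapCost.work + a.attrCost.work + a.removeCost.work) 13 3
    (A.alternative B).iters fun i hi => by simpa only [(a2 i hi).2] using (hb i hi).2
  have h2 := List.sum_map_le_mul_add
    (fun a : AIter S => a.trapCost.work + a.attrCost.work + a.removeCost.work)
    (fun a : AIter S => a.trapCost.steps + a.attrCost.steps + a.removeCost.steps) 1 0
    (A.alternative B).iters fun i hi => by simpa only [one_mul, ite_self, add_zero] using (hb i hi).1
  have hw : (A.alternative B).initCost.work = G.E.card := (A.aInit_spec B).2.1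
  have hs : (A.alternative B).initCost.steps = A.states.length + G.E.card := (A.aInit_spec B).2.2
  have hS := G.card_le_card_edges
  rw [← A.length_states] at hS
  unfold ARun.work ARun.steps
  omega

/-- Initialization and all deletions each handle every state and every edge at most once, and there
are at most `m` states since each has an outgoing edge. -/
theorem AdjList.maintenanceSteps_le : (A.alternative B).maintenanceSteps ≤ 4 * G.E.card := by
  obtain ⟨-, a2⟩ := A.alternative_spec B
  have h1 := List.sum_map_le_sum_map_add (fun a : AIter S => a.removeCost.steps)
    (fun _ : AIter S => 0)
    (fun i => (G.attr₂ (G.stateSeq (G.altTrap B) i)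
      (G.altTrap B (G.stateSeq (G.altTrap B) i))).ncard +
      (G.edgesInto (G.stateSeq (G.altTrap B) i) (G.attr₂ (G.stateSeq (G.altTrap B) i)
        (G.altTrap B (G.stateSeq (G.altTrap B) i))) ∪
      G.edgesFrom (G.stateSeq (G.altTrap B) i) (G.attr₂ (G.stateSeq (G.altTrap B) i)
        (G.altTrap B (G.stateSeq (G.altTrap B) i)))).ncard)
    (A.alternative B).iters (A.alternative B).iters rfl fun i hi _ => by
      have h := (a2 i hi).1.costs
      rw [h.remove_steps, h.remove_work, zero_add]
  rw [List.map_const', List.sum_replicate, smul_zero, zero_add, Finset.sum_add_distrib] at h1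
  have h2 := G.sum_ncard_edges_add (G.altTrap B) (A.alternative B).iters.length
  have h3 := G.sum_ncard_attr₂_add (G.altTrap B) (A.alternative B).iters.length
  have hs : (A.alternative B).initCost.steps = A.states.length + G.E.card := (A.aInit_spec B).2.2
  have hS := G.card_le_card_edges
  rw [A.length_states] at hs
  unfold ARun.maintenanceSteps
  omega

end GameGraph

theorem mainTheorem2 :
    ∃ c : ℕ, ∀ (S : Type*) [Fintype S] [DecidableEq S] (G : GameGraph S) (A : G.AdjList)
      (B : Finset S),
      -- the step-counted programs perform the two algorithms
      (A.classical B).Computes G B ∧ (A.alternative B).Computes G B ∧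
      -- the running time bound, for the work measure
      (A.alternative B).work ≤ (A.classical B).work + c * G.E.card ∧
      -- work is the number of elementary steps up to a constant factor
      ((A.classical B).work ≤ (A.classical B).steps ∧
        (A.classical B).steps ≤ c * ((A.classical B).work + 1)) ∧
      ((A.alternative B).work ≤ (A.alternative B).steps ∧
        (A.alternative B).steps ≤ c * ((A.alternative B).work + 1)) ∧
      -- the resulting bound for the number of elementary steps
      (A.alternative B).steps ≤ c * ((A.classical B).steps + G.E.card) ∧
      -- where the extra work is done: maintenance of the candidate sets, and trap edges
      (A.alternative B).maintenanceSteps ≤ c * G.E.card ∧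
      (A.alternative B).iters.length = (A.classical B).iters.length ∧
      (∀ (i : ℕ) (h₂ : i < (A.alternative B).iters.length)
        (h₁ : i < (A.classical B).iters.length),
        (A.alternative B).iters[i].trapCost.work ≤
          (A.classical B).iters[i].trapCost.work + c * (G.trapEdges B i).ncard) ∧
      ∑ i ∈ Finset.range (A.alternative B).iters.length, (G.trapEdges B i).ncard ≤ G.E.card := by

  -- The largest factor that occurs. The comparison of steps chains `T₂ ≤ 13 (RT₂ + 1) ≤ 13 (RT₁ + 1
  -- + m)` with `RT₁ + 1 ≤ T₁`, so it needs no further additive constant.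
  refine ⟨13, fun S _ _ G A B => ?_⟩
  have hw := A.alternative_work_le B
  obtain ⟨c1, c2⟩ := A.classical_steps_bounds B
  obtain ⟨a1, a2⟩ := A.alternative_steps_bounds B
  have hm := A.maintenanceSteps_le B
  refine ⟨A.classical_computes B, A.alternative_computes B, by omega, ⟨by omega, by omega⟩,
    ⟨a1, a2⟩, by omega, by omega, A.length_alternative B, fun i h₂ h₁ => ?_,
    G.sum_trapEdges_le B _⟩
  have := A.alternative_trapCost_work_le B i h₂ h₁
  omega
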